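/- Let $v_1<\dots<v_k$ be real numbers (the alphabet), let $P_X,P_Y$ be probability mass functions (pmfs) on it, and let logarithms be to base $2$. Put $D(P\|Q)=\sum_a P(a)\log\frac{P(a)}{Q(a)}\in[0,\infty]$, with $0\log 0=0$ and $p\log\frac p0=\infty$ for $p>0$. For a map $S=(S(i,j))$ write $d(S)=\max\{|v_i-v_j| : S(i,j)\neq 0\}$. For pmfs $P,Q$ let $S^{\rm NWC}_{PQ}$ be the transportation map from $P$ to $Q$ given by the north-west corner rule: starting from the first bins $i$ of $P$ and $j$ of $Q$, ship $\min\{P(i),Q(j)\}$ from $i$ to $j$, subtract it from both bins, pass to the next bin of $P$ (of $Q$) if the current one has become empty, and repeat until everything has been shipped. Source identification game with known sources, $L_\infty$ distance, $L\ge 0$ and $\lambda>0$. For each $n$, the defender chooses a set $\Lambda$ of types (empirical pmfs of sequences of length $n$) such that $P_{fp}=P_X^n\{x^n:\text{type of }x^n\notin\Lambda\}\le 2^{-\lambda n}$. The attacker assigns to each sequence $y^n$ a map $S(y^n)$ with entries in $\frac1n\mathbb N$, with input marginal $\sum_jS(i,j)$ equal to the type of $y^n$, and with $d(S)\le L$;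 its output marginal is $S_Z(j)=\sum_i S(i,j)$. The false negative probability is $P_{fn}=P_Y^n\{y^n:S_Z(y^n)\in\Lambda\}$, which the defender wants small and the attacker wants large. The (asymptotic) equilibrium profile consists of $\Lambda^{n,*}=\{P \text{ a type}: D(P\|P_X)<\lambda-k\frac{\log(n+1)}{n}\}$ and of any $S^{n,*}$ that for each $y^n$ minimizes $D(S_Z\|P_X)$ over the admissible maps. Let $\Gamma_{L_\infty}(P_X,L)=\{P\text{ a pmf}: d(S^{\rm NWC}_{PP_X})\le L\}$. 1. For every $L\ge0$ the minimum of $D(P\|P_Y)$ over $\Gamma_{L_\infty}(P_X,L)$ is attained and $$\lim_{\lambda\to0^+}\ \lim_{n\to\infty}-\frac1n\log P_{fn}=\min_{P\in\Gamma_{L_\infty}(P_X,L)}D(P\|P_Y)$$ in $[0,\infty]$. Here $P_{fn}$ is the false negative probability at the equilibrium profile, and the inner limit $\varepsilon(\lambda)$ exists for every $\lambda>0$ and is the same for every choice of $S^{n,*}$. For all sufficiently small $\lambda>0$, $\varepsilon(\lambda)$ is also the limit of $-\frac1n\log$ of the min-max value $\min_\Lambda\max_S P_{fn}$ of the game, so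 that it is the maximum achievable false negative error exponent. 2. Call $X$ and $Y$ reliably distinguishable at distortion $L\ge 0$ if for some $\lambda>0$ and $e>0$ the defender has strategies with $P_{fp}\le2^{-\lambda n}$ for all $n$ and with $P_{fn}\le 2^{-en}$ for all large $n$ against every attacker's strategy. For every $L\ge0$ this holds if and only if $L<d(S^{\rm NWC}_{P_YP_X})$. Consequently the security margin, i.e. the supremum of the $L\ge0$ at which $X$ and $Y$ are reliably distinguishable ($0$ if there is none), equals $d(S^{\rm NWC}_{P_YP_X})$. -/

import Mathlib

open Filter Topology

/-! The alphabet consists of `k` real symbols `v 0 < v 1 < ... < v (k - 1)`. A pmf is an element of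
`stdSimplex ℝ (Fin k)`. All logarithms are to base two. -/

/-- Divergence (in bits) of two pmfs, with `0 log 0 = 0` and `p log (p / 0) = ∞` for `p > 0`. -/
noncomputable def klBits {k : ℕ} (P Q : Fin k → ℝ) : EReal :=
  open Classical in
  if ∀ a, Q a = 0 → P a = 0 then ((∑ a, P a * Real.logb 2 (P a / Q a) : ℝ) : EReal) else ⊤

/-- `-(1/n) log₂ p` for a probability `p`, with value `+∞` at `p = 0`. -/
noncomputable def errorExponent (n : ℕ) (p : ℝ) : EReal :=
  open Classical in
  if p = 0 then ⊤ else ((-(1 / (n : ℝ)) * Real.logb 2 p : ℝ) : EReal)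

/-- The type (empirical pmf) of a sequence of length `n`. -/
noncomputable def empiricalPmf {k n : ℕ} (y : Fin n → Fin k) : Fin k → ℝ :=
  fun a => ((Finset.univ.filter (fun t => y t = a)).card : ℝ) / n

/-- The set of types with denominator `n`. -/
def typesOfLength (k n : ℕ) : Set (Fin k → ℝ) :=
  Set.range (fun y : Fin n → Fin k => empiricalPmf y)

/-- Probability that a memoryless source with pmf `P` emits the sequence `y`. -/
noncomputable def seqProb {k n : ℕ} (P : Fin k → ℝ) (y : Fin n → Fin k) : ℝ := ∏ t, P (y t)

/-- `max |v i - v j|` over the pairs `(i, j)` with a nonzero shipment `S i j`. -/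
noncomputable def maxShipment {k : ℕ} (v : Fin k → ℝ) (S : Fin k → Fin k → ℝ) : ℝ :=
  sSup {d : ℝ | ∃ i j, S i j ≠ 0 ∧ d = |v i - v j|}

/-- The admissible transportation maps (for sequences of length `n`) applicable to a sequence of
type `P`: the entries are `n(i,j) / n` with `n(i,j)` natural numbers, the input marginal is `P`,
and the maximum absolute distance is at most `L`. -/
def admissibleMaps {k : ℕ} (v : Fin k → ℝ) (L : ℝ) (n : ℕ) (P : Fin k → ℝ) :
    Set (Fin k → Fin k → ℝ) :=
  {S | (∃ N : Fin k → Fin k → ℕ, ∀ i j, S i j = (N i j : ℝ) / n) ∧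
    (∀ i, ∑ j, S i j = P i) ∧ maxShipment v S ≤ L}

/-- The output marginal of a transportation map. -/
def outputMarginal {k : ℕ} (S : Fin k → Fin k → ℝ) : Fin k → ℝ := fun j => ∑ i, S i j

/-- Probability that a sequence emitted by the source `PX` falls outside the acceptance region. -/
noncomputable def falsePos {k : ℕ} (PX : Fin k → ℝ) (n : ℕ) (A : Set (Fin k → ℝ)) : ℝ :=
  open Classical in
  ∑ x : Fin n → Fin k, if empiricalPmf x ∈ A then 0 else seqProb PX x

/-- Probability that a sequence emitted by the source `PY` and attacked with the strategy `S`
falls inside the acceptance region. -/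
noncomputable def falseNeg {k : ℕ} (PY : Fin k → ℝ) (n : ℕ) (A : Set (Fin k → ℝ))
    (S : (Fin n → Fin k) → Fin k → Fin k → ℝ) : ℝ :=
  open Classical in
  ∑ y : Fin n → Fin k, if outputMarginal (S y) ∈ A then seqProb PY y else 0

/-- The defender's strategies: sets of types with false positive probability at most
`2 ^ (-lam * n)`. -/
def defenderStrategies {k : ℕ} (PX : Fin k → ℝ) (lam : ℝ) (n : ℕ) : Set (Set (Fin k → ℝ)) :=
  {A | A ⊆ typesOfLength k n ∧ falsePos PX n A ≤ (2 : ℝ) ^ (-(lam * n))}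

/-- The attacker's strategies: rules that associate an admissible map to each sequence. -/
def attackerStrategies {k : ℕ} (v : Fin k → ℝ) (L : ℝ) (n : ℕ) :
    Set ((Fin n → Fin k) → Fin k → Fin k → ℝ) :=
  {S | ∀ y, S y ∈ admissibleMaps v L n (empiricalPmf y)}

/-- The smallest false negative probability which the defender can guarantee in the game with
sequences of length `n`. -/
noncomputable def gameFalseNeg {k : ℕ} (v : Fin k → ℝ) (PX PY : Fin k → ℝ) (L lam : ℝ) (n : ℕ) :
    ℝ :=
  sInf ((fun A => sSup ((fun S => falseNeg PY n A S) '' attackerStrategies v L n)) ''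
    defenderStrategies PX lam n)

/-- The equilibrium acceptance region. -/
def optimalRegion {k : ℕ} (PX : Fin k → ℝ) (lam : ℝ) (n : ℕ) : Set (Fin k → ℝ) :=
  {P | P ∈ typesOfLength k n ∧
    klBits P PX < ((lam - k * (Real.logb 2 (n + 1) / n) : ℝ) : EReal)}

/-- `S` is an equilibrium attack: each sequence is attacked with an admissible map minimizing the
divergence of the output type from `PX`. -/
def IsOptimalAttack {k : ℕ} (v : Fin k → ℝ) (PX : Fin k → ℝ) (L : ℝ) (n : ℕ)
    (S : (Fin n → Fin k) → Fin k → Fin k → ℝ) : Prop :=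
  S ∈ attackerStrategies v L n ∧
    ∀ y, ∀ T ∈ admissibleMaps v L n (empiricalPmf y),
      klBits (outputMarginal (S y)) PX ≤ klBits (outputMarginal T) PX

/-- State of the north-west corner algorithm: current bins, remaining supply and demand, and the
shipments made so far. -/
structure NWCState (k : ℕ) where
  i : ℕ
  j : ℕ
  supply : Fin k → ℝ
  demand : Fin k → ℝ
  map : Fin k → Fin k → ℝ

open Classical in
/-- One step of the north-west corner rule: ship as much as possible from bin `i` to bin `j`; then
go on with the next supply bin if bin `i` is emptied, and with the next demand bin if bin `j` is
filled. Nothing happens once one of the indices has passed the last bin. -/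
noncomputable def NWCState.step {k : ℕ} (s : NWCState k) : NWCState k :=
  if h : s.i < k ∧ s.j < k then
    let a : Fin k := ⟨s.i, h.1⟩
    let b : Fin k := ⟨s.j, h.2⟩
    let m : ℝ := min (s.supply a) (s.demand b)
    { i := if s.supply a - m = 0 then s.i + 1 else s.i
      j := if s.demand b - m = 0 then s.j + 1 else s.j
      supply := Function.update s.supply a (s.supply a - m)
      demand := Function.update s.demand b (s.demand b - m)
      map := Function.update s.map a (Function.update (s.map a) b m) }
  else s

/-- The transportation map obtained by applying the north-west corner rule to `P` (supply) and `Q`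
(demand). Each step passes at least one bin, so that `2 * k` steps complete the procedure; empty
bins are passed with a zero shipment. -/
noncomputable def nwcMap {k : ℕ} (P Q : Fin k → ℝ) : Fin k → Fin k → ℝ :=
  (NWCState.step^[2 * k] ⟨0, 0, P, Q, fun _ _ => 0⟩).map

/-- The pmfs whose north-west corner map to `PX` has maximal shipment distance at most `L`. -/
def smallestRegion {k : ℕ} (v : Fin k → ℝ) (PX : Fin k → ℝ) (L : ℝ) : Set (Fin k → ℝ) :=
  {P | P ∈ stdSimplex ℝ (Fin k) ∧ maxShipment v (nwcMap P PX) ≤ L}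

/-- The defender can ensure strictly positive error exponents of both kinds, whatever the attack
with maximum absolute distance at most `L`. -/
def ReliablyDistinguishable {k : ℕ} (v : Fin k → ℝ) (PX PY : Fin k → ℝ) (L : ℝ) : Prop :=
  ∃ lam > (0 : ℝ), ∃ e > (0 : ℝ), ∃ A : ℕ → Set (Fin k → ℝ),
    (∀ n, A n ∈ defenderStrategies PX lam n) ∧
    ∀ᶠ n : ℕ in atTop, ∀ S ∈ attackerStrategies v L n,
      falseNeg PY n (A n) S ≤ (2 : ℝ) ^ (-(e * n))

/-- Security margin of the game with maximum absolute distance. -/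
noncomputable def securityMargin {k : ℕ} (v : Fin k → ℝ) (PX PY : Fin k → ℝ) : ℝ :=
  sSup {L : ℝ | 0 ≤ L ∧ ReliablyDistinguishable v PX PY L}

/-! Everything reduces to `reachProb`, the probability that a sequence drawn from `PY` can be moved
within distance `L` into a divergence ball around `PX`. Against the equilibrium region, every
optimal attack succeeds on exactly such sequences. For the game itself, a type class inside the ball
of radius λ - k log(n+1)/n has `PX`-probability above 2^(-λn), so every admissible region contains
all types in that ball (`optimalRegion_subset`), while the ball of radius λ + k log(n+1)/n is
admissible. The game value thus lies between two values of `reachProb` whose radii tend to λ.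

A Sanov argument over transportation maps gives `reachProb` the exponent `limitExponent`: the
infimum of the divergence of the input marginal from `PY`, over feasible maps whose output marginal
has divergence from `PX` below λ. Feasible maps form a compact convex set; their support conditions
make `klReal` agree with `klBits`, and `klReal` is continuous and convex. Convexity gives the right
semicontinuity in λ that the game value requires. Compactness and Gibbs' inequality give, as λ → 0,
the minimum over maps with output exactly `PX`.

The input marginals of maps to `PX` with shipments over at most `L` are exactly Γ, because the
north-west corner map minimizes the largest shipment (`maxShipment_nwcMap_le_iff`): it ships from a
to b only when the cumulative-mass intervals of the two bins overlap, and such an overlap forces any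
other map to ship at least as far. By Gibbs the minimum over Γ is positive iff `PY` is outside Γ,
which yields the security margin. -/

/-! ### The method of types -/

/-- The divergence in bits as a real number; it agrees with `klBits` whenever the latter is
finite, and is a continuous function of its first argument. -/
noncomputable def klReal {k : ℕ} (P Q : Fin k → ℝ) : ℝ := ∑ a, P a * Real.logb 2 (P a / Q a)

/-- The number of occurrences of each symbol in a sequence. -/
def symbolCount {k n : ℕ} (y : Fin n → Fin k) : Fin k → ℕ :=
  fun a => (Finset.univ.filter (fun t => y t = a)).card

theorem empiricalPmf_apply {k n : ℕ} (y : Fin n → Fin k) (a : Fin k) :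
    empiricalPmf y a = (symbolCount y a : ℝ) / n := rfl

theorem sum_symbolCount {k n : ℕ} (y : Fin n → Fin k) : ∑ a, symbolCount y a = n := by
  have := Finset.card_eq_sum_card_fiberwise (f := y) (s := Finset.univ) (t := Finset.univ)
    (fun _ _ => Finset.mem_coe.2 (Finset.mem_univ _))
  simpa [symbolCount] using this.symm

theorem sum_empiricalPmf {k n : ℕ} (hn : n ≠ 0) (y : Fin n → Fin k) :
    ∑ a, empiricalPmf y a = 1 := by
  have h : (∑ a, (symbolCount y a : ℝ)) = n := by exact_mod_cast sum_symbolCount y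
  simp_rw [empiricalPmf_apply, ← Finset.sum_div, h]
  exact div_self (by exact_mod_cast hn)

theorem seqProb_eq_prod {k n : ℕ} (P : Fin k → ℝ) (y : Fin n → Fin k) :
    seqProb P y = ∏ a, P a ^ symbolCount y a := by
  unfold seqProb symbolCount
  rw [← Finset.prod_fiberwise' Finset.univ y P]
  exact Finset.prod_congr rfl fun a _ => by rw [Finset.prod_const]

theorem seqProb_nonneg {k n : ℕ} {P : Fin k → ℝ} (hP : ∀ a, 0 ≤ P a) (y : Fin n → Fin k) :
    0 ≤ seqProb P y := Finset.prod_nonneg fun t _ => hP (y t)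

theorem sum_seqProb {k : ℕ} (n : ℕ) {P : Fin k → ℝ} (hP : ∑ a, P a = 1) :
    ∑ y : Fin n → Fin k, seqProb P y = 1 := by
  simp_rw [seqProb, ← Fintype.sum_pow, hP, one_pow]

theorem empiricalPmf_eq_zero_of_seqProb_ne_zero {k n : ℕ} {Q : Fin k → ℝ} {y : Fin n → Fin k}
    (h : seqProb Q y ≠ 0) (a : Fin k) (ha : Q a = 0) : empiricalPmf y a = 0 := by
  rw [seqProb_eq_prod] at h
  have := Finset.prod_ne_zero_iff.1 h a (Finset.mem_univ a)
  rw [ha] at this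
  have h0 : symbolCount y a = 0 := by
    by_contra h0
    exact this (zero_pow h0)
  simp [empiricalPmf_apply, h0]

/-- The probability of a sequence factors through the divergence of its type. -/
theorem seqProb_eq_rpow_mul {k n : ℕ} (hn : n ≠ 0) {Q : Fin k → ℝ} (hQ : ∀ a, 0 ≤ Q a)
    {y : Fin n → Fin k} (h : ∀ a, Q a = 0 → empiricalPmf y a = 0) :
    seqProb Q y = (2 : ℝ) ^ (-(n * klReal (empiricalPmf y) Q)) * seqProb (empiricalPmf y) y := by
  have hn' : (0 : ℝ) < n := by exact_mod_cast Nat.pos_of_ne_zero hn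
  have hsum : -(n * klReal (empiricalPmf y) Q) =
      ∑ a, Real.logb 2 (empiricalPmf y a / Q a) * (-(symbolCount y a : ℝ)) := by
    rw [klReal, Finset.mul_sum, ← Finset.sum_neg_distrib]
    refine Finset.sum_congr rfl fun a _ => ?_
    have : (symbolCount y a : ℝ) = n * empiricalPmf y a := by
      rw [empiricalPmf_apply]; field_simp
    rw [this]; ring
  rw [hsum, Real.rpow_sum_of_pos two_pos, seqProb_eq_prod, seqProb_eq_prod,
    ← Finset.prod_mul_distrib]
  refine Finset.prod_congr rfl fun a _ => ?_
  rcases Nat.eq_zero_or_pos (symbolCount y a) with h0 | h0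
  · simp [h0]
  · have hP : 0 < empiricalPmf y a := by
      rw [empiricalPmf_apply]
      have : (0 : ℝ) < symbolCount y a := by exact_mod_cast h0
      positivity
    have hQa : 0 < Q a := lt_of_le_of_ne (hQ a) fun e => hP.ne' (h a e.symm)
    rw [Real.rpow_mul two_pos.le, Real.rpow_logb two_pos (by norm_num) (div_pos hP hQa),
      Real.rpow_neg (div_pos hP hQa).le, Real.rpow_natCast, div_pow]
    field_simp

/-- The maximum likelihood probabilities of the sequences of length `n` sum up to at most the
number of types. -/
theorem sum_seqProb_empiricalPmf_le {k n : ℕ} (hn : n ≠ 0) :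
    ∑ y : Fin n → Fin k, seqProb (empiricalPmf y) y ≤ ((n : ℝ) + 1) ^ k := by
  classical
  have hn' : (0 : ℝ) < n := by exact_mod_cast Nat.pos_of_ne_zero hn
  let p : (Fin k → Fin (n + 1)) → Fin k → ℝ := fun m a => ((m a : ℕ) : ℝ) / n
  let M := Finset.univ.filter fun m : Fin k → Fin (n + 1) => ∑ a, (m a : ℕ) = n
  have hp : ∀ m a, 0 ≤ p m a := fun m a => by positivity
  have key : ∀ y : Fin n → Fin k, seqProb (empiricalPmf y) y ≤ ∑ m ∈ M, seqProb (p m) y := by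
    intro y
    have hlt : ∀ a, symbolCount y a < n + 1 := fun a => by
      have := Finset.single_le_sum (f := symbolCount y) (fun _ _ => Nat.zero_le _)
        (Finset.mem_univ a)
      rw [sum_symbolCount] at this
      omega
    obtain ⟨m, hm⟩ : ∃ m : Fin k → Fin (n + 1), ∀ a, (m a : ℕ) = symbolCount y a :=
      ⟨fun a => ⟨symbolCount y a, hlt a⟩, fun a => rfl⟩
    have hmM : m ∈ M := Finset.mem_filter.2 ⟨Finset.mem_univ m, by simp_rw [hm, sum_symbolCount]⟩
    have hpm : empiricalPmf y = p m := by
      funext a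
      simp only [p, hm, empiricalPmf_apply]
    rw [hpm]
    exact Finset.single_le_sum (f := fun m => seqProb (p m) y)
      (fun m _ => seqProb_nonneg (hp m) y) hmM
  calc ∑ y : Fin n → Fin k, seqProb (empiricalPmf y) y
      ≤ ∑ y : Fin n → Fin k, ∑ m ∈ M, seqProb (p m) y := Finset.sum_le_sum fun y _ => key y
    _ = ∑ m ∈ M, ∑ y : Fin n → Fin k, seqProb (p m) y := Finset.sum_comm
    _ = ∑ m ∈ M, 1 := by
        refine Finset.sum_congr rfl fun m hm => sum_seqProb n ?_
        simp only [M, Finset.mem_filter, Finset.mem_univ, true_and] at hm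
        have : (∑ a, ((m a : ℕ) : ℝ)) = n := by exact_mod_cast hm
        simp only [p, ← Finset.sum_div, this, div_self hn'.ne']
    _ = (M.card : ℝ) := by simp
    _ ≤ ((n : ℝ) + 1) ^ k := by
        have : M.card ≤ (n + 1) ^ k := by
          refine (Finset.card_le_univ M).trans ?_
          simp
        exact_mod_cast this

/-- A set of sequences whose types all have divergence at least `c` from `Q` has probability at
most `(n + 1) ^ k * 2 ^ (-(n * c))`. -/
theorem sum_seqProb_le_of_le_klReal {k n : ℕ} (hn : n ≠ 0) {Q : Fin k → ℝ} (hQ : ∀ a, 0 ≤ Q a)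
    (Y : Finset (Fin n → Fin k)) {c : ℝ}
    (h : ∀ y ∈ Y, seqProb Q y ≠ 0 → c ≤ klReal (empiricalPmf y) Q) :
    ∑ y ∈ Y, seqProb Q y ≤ ((n : ℝ) + 1) ^ k * (2 : ℝ) ^ (-(n * c)) := by
  have hemp : ∀ y : Fin n → Fin k, 0 ≤ seqProb (empiricalPmf y) y := fun y =>
    seqProb_nonneg (fun a => by rw [empiricalPmf_apply]; positivity) y
  calc ∑ y ∈ Y, seqProb Q y
      ≤ ∑ y ∈ Y, (2 : ℝ) ^ (-(n * c)) * seqProb (empiricalPmf y) y := by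
        refine Finset.sum_le_sum fun y hy => ?_
        by_cases h0 : seqProb Q y = 0
        · rw [h0]
          exact mul_nonneg (by positivity) (hemp y)
        · rw [seqProb_eq_rpow_mul hn hQ (empiricalPmf_eq_zero_of_seqProb_ne_zero h0)]
          refine mul_le_mul_of_nonneg_right ?_ (hemp y)
          refine Real.rpow_le_rpow_of_exponent_le one_le_two ?_
          have := mul_le_mul_of_nonneg_left (h y hy h0) (Nat.cast_nonneg (α := ℝ) n)
          linarith
    _ = (2 : ℝ) ^ (-(n * c)) * ∑ y ∈ Y, seqProb (empiricalPmf y) y := by rw [Finset.mul_sum]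
    _ ≤ (2 : ℝ) ^ (-(n * c)) * ((n : ℝ) + 1) ^ k := by
        refine mul_le_mul_of_nonneg_left ?_ (by positivity)
        exact (Finset.sum_le_univ_sum_of_nonneg hemp).trans (sum_seqProb_empiricalPmf_le hn)
    _ = _ := mul_comm _ _

/-! ### Size and probability of type classes -/

theorem symbolCount_cons {k n : ℕ} (a : Fin k) (y : Fin n → Fin k) :
    symbolCount (Fin.cons a y : Fin (n + 1) → Fin k) = symbolCount y + Pi.single a 1 := by
  funext b
  have h : (Finset.univ.filter fun t => (Fin.cons a y : Fin (n + 1) → Fin k) t = b).card =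
      (if a = b then 1 else 0) + (Finset.univ.filter fun t => y t = b).card := by
    rw [Fin.card_filter_univ_succ]
    by_cases hab : a = b <;> simp [hab, add_comm]
  simp only [symbolCount, h, Pi.add_apply, Pi.single_apply]
  rw [add_comm]
  simp [eq_comm]

open Nat in
/-- The number of sequences with prescribed symbol counts is a multinomial coefficient. -/
theorem card_symbolCount_mul_prod_factorial {k : ℕ} (n : ℕ) (c : Fin k → ℕ) (hc : ∑ a, c a = n) :
    (Finset.univ.filter fun y : Fin n → Fin k => symbolCount y = c).card * ∏ a, (c a)! = n ! := by
  classical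
  induction n generalizing c with
  | zero =>
    have h0 : c = 0 := by
      funext a
      exact (Finset.sum_eq_zero_iff.1 hc) a (Finset.mem_univ a)
    subst h0
    have : (Finset.univ.filter fun y : Fin 0 → Fin k => symbolCount y = 0) = Finset.univ := by
      refine Finset.filter_true_of_mem fun y _ => ?_
      funext a
      simp [symbolCount]
    rw [this]
    simp
  | succ n ih =>
    -- Splitting by the first symbol `a` gives the multinomial Pascal recursion; each term
    -- contributes `c a * n !`, and the `c a` add up to `n + 1`.
    have hsplit : (Finset.univ.filter fun y : Fin (n + 1) → Fin k => symbolCount y = c).card =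
        ∑ a, (Finset.univ.filter fun y : Fin n → Fin k =>
          symbolCount y + Pi.single a 1 = c).card := by
      simp only [Finset.card_filter]
      rw [← (Fin.consEquiv fun _ : Fin (n + 1) => Fin k).sum_comp, Fintype.sum_prod_type]
      refine Finset.sum_congr rfl fun a _ => Finset.sum_congr rfl fun y _ => ?_
      have h : symbolCount ((Fin.consEquiv fun _ : Fin (n + 1) => Fin k) (a, y)) =
          symbolCount y + Pi.single a 1 := symbolCount_cons a y
      simp only [h]
    rw [hsplit, Finset.sum_mul]
    have hterm : ∀ a, (Finset.univ.filter fun y : Fin n → Fin k =>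
        symbolCount y + Pi.single a 1 = c).card * ∏ b, (c b)! = c a * n ! := by
      intro a
      rcases Nat.eq_zero_or_pos (c a) with h0 | h0
      · rw [Finset.filter_false_of_mem, h0]
        · simp
        · intro y _ hy
          have := congrFun hy a
          simp [h0] at this
      · have hle : Pi.single a 1 ≤ c := by
          intro b
          by_cases hb : b = a
          · subst hb; simpa using Nat.succ_le_of_lt h0
          · simp [hb]
        obtain ⟨d, hd⟩ : ∃ d : Fin k → ℕ, d + Pi.single a 1 = c :=
          ⟨c - Pi.single a 1, tsub_add_cancel_of_le hle⟩
        have heq : ∀ y : Fin n → Fin k, symbolCount y + Pi.single a 1 = c ↔ symbolCount y = d :=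
          fun y => by rw [← hd, add_left_inj]
        simp_rw [heq]
        have hca : c a = d a + 1 := by simp [← hd]
        have hprod : ∏ b, (c b)! = c a * ∏ b, (d b)! := by
          rw [← Finset.mul_prod_erase _ _ (Finset.mem_univ a),
            ← Finset.mul_prod_erase _ (fun b => (d b)!) (Finset.mem_univ a), ← mul_assoc]
          congr 1
          · rw [hca, Nat.factorial_succ]
          · refine Finset.prod_congr rfl fun b hb => ?_
            rw [← hd]
            simp [Finset.ne_of_mem_erase hb]
        have hsum : ∑ b, d b = n := by
          rw [← hd] at hc
          simpa [Finset.sum_add_distrib] using hc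
        rw [hprod, mul_left_comm, ih _ hsum]
    rw [Finset.sum_congr rfl fun a _ => hterm a, ← Finset.sum_mul, hc, Nat.factorial_succ]

theorem exists_symbolCount_eq {k n : ℕ} (c : Fin k → ℕ) (hc : ∑ a, c a = n) :
    ∃ y : Fin n → Fin k, symbolCount y = c := by
  have h := card_symbolCount_mul_prod_factorial n c hc
  have hpos : 0 < (Finset.univ.filter fun y : Fin n → Fin k => symbolCount y = c).card := by
    refine Nat.pos_of_ne_zero fun h0 => ?_
    rw [h0, zero_mul] at h
    exact (Nat.factorial_pos n).ne h
  obtain ⟨y, hy⟩ := Finset.card_pos.1 hpos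
  exact ⟨y, (Finset.mem_filter.1 hy).2⟩

-- The quotient l!/m! has |l - m| factors, each at most l if l ≥ m and its inverse at least l^(m-l)
-- otherwise. Multiplied over the symbols, this shows that a type class is the likeliest one under
-- its own type.
open Nat in
theorem factorial_mul_pow_le (l m : ℕ) : l ! * l ^ m ≤ m ! * l ^ l := by
  rcases le_total l m with h | h
  · calc l ! * l ^ m = l ! * l ^ (m - l) * l ^ l := by
          rw [mul_assoc, ← pow_add, Nat.sub_add_cancel h]
      _ ≤ m ! * l ^ l := Nat.mul_le_mul_right _ (Nat.factorial_mul_pow_sub_le_factorial h)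
  · calc l ! * l ^ m = m ! * (l.descFactorial (l - m)) * l ^ m := by
          rw [← Nat.factorial_mul_descFactorial (Nat.sub_le l m), Nat.sub_sub_self h]
      _ ≤ m ! * l ^ (l - m) * l ^ m :=
          Nat.mul_le_mul_right _ (Nat.mul_le_mul_left _ (Nat.descFactorial_le_pow _ _))
      _ = m ! * l ^ l := by rw [mul_assoc, ← pow_add, Nat.sub_add_cancel h]

/-- A type class is the most likely one under its own type. -/
theorem card_mul_prod_pow_le {k n : ℕ} (p q : Fin k → ℕ) (hp : ∑ a, p a = n)
    (hq : ∑ a, q a = n) :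
    (Finset.univ.filter fun y : Fin n → Fin k => symbolCount y = q).card * ∏ a, p a ^ q a ≤
      (Finset.univ.filter fun y : Fin n → Fin k => symbolCount y = p).card * ∏ a, p a ^ p a := by
  have hp' := card_symbolCount_mul_prod_factorial n p hp
  have hq' := card_symbolCount_mul_prod_factorial n q hq
  have hpp : 0 < ∏ a, (p a).factorial := Finset.prod_pos fun a _ => Nat.factorial_pos _
  have hqp : 0 < ∏ a, (q a).factorial := Finset.prod_pos fun a _ => Nat.factorial_pos _
  have h := Finset.prod_le_prod' (s := Finset.univ) fun a _ => factorial_mul_pow_le (p a) (q a)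
  rw [Finset.prod_mul_distrib, Finset.prod_mul_distrib] at h
  refine Nat.le_of_mul_le_mul_right ?_ (Nat.mul_pos hpp hqp)
  generalize (Finset.univ.filter fun y : Fin n → Fin k => symbolCount y = q).card = Nq at *
  generalize (Finset.univ.filter fun y : Fin n → Fin k => symbolCount y = p).card = Np at *
  generalize ∏ a, (p a).factorial = Fp at *
  generalize ∏ a, (q a).factorial = Fq at *
  generalize ∏ a, p a ^ q a = A at *
  generalize ∏ a, p a ^ p a = B at *
  -- Both `Nq * Fq` and `Np * Fp` equal n!, so the class sizes can be exchanged.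
  calc Nq * A * (Fp * Fq) = (Nq * Fq) * (Fp * A) := by ring
    _ ≤ (Nq * Fq) * (Fq * B) := Nat.mul_le_mul_left _ h
    _ = (Np * Fp) * (Fq * B) := by rw [hp', hq']
    _ = Np * B * (Fp * Fq) := by ring

theorem sum_seqProb_typeClass {k n : ℕ} (P : Fin k → ℝ) (q : Fin k → ℕ) :
    ∑ y : Fin n → Fin k with symbolCount y = q, seqProb P y =
      (Finset.univ.filter fun y : Fin n → Fin k => symbolCount y = q).card * ∏ a, P a ^ q a := by
  rw [Finset.sum_congr rfl (g := fun _ => ∏ a, P a ^ q a), Finset.sum_const, nsmul_eq_mul]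
  intro y hy
  rw [seqProb_eq_prod, (Finset.mem_filter.1 hy).2]

/-- Lower bound on the probability of a type class under its own type. -/
theorem one_le_mul_sum_seqProb_typeClass {k n : ℕ} (hn : n ≠ 0) (p : Fin k → ℕ)
    (hp : ∑ a, p a = n) :
    1 ≤ ((n : ℝ) + 1) ^ k *
      ∑ y : Fin n → Fin k with symbolCount y = p, seqProb (fun a => (p a : ℝ) / n) y := by
  classical
  have hn' : (0 : ℝ) < n := by exact_mod_cast Nat.pos_of_ne_zero hn
  set P : Fin k → ℝ := fun a => (p a : ℝ) / n with hP
  have hle : ∀ q : Fin k → ℕ, ∑ a, q a = n →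
      ∑ y : Fin n → Fin k with symbolCount y = q, seqProb P y ≤
      ∑ y : Fin n → Fin k with symbolCount y = p, seqProb P y := by
    intro q hq
    have hprod : ∀ r : Fin k → ℕ, ∑ a, r a = n →
        ∏ a, P a ^ r a = ((∏ a, p a ^ r a : ℕ) : ℝ) / (n : ℝ) ^ n := by
      intro r hr
      simp only [hP, div_pow, Finset.prod_div_distrib, Finset.prod_pow_eq_pow_sum, hr]
      push_cast
      rfl
    rw [sum_seqProb_typeClass, sum_seqProb_typeClass, hprod q hq, hprod p hp, ← mul_div_assoc,
      ← mul_div_assoc]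
    refine div_le_div_of_nonneg_right ?_ (by positivity)
    exact_mod_cast card_mul_prod_pow_le p q hp hq
  have hsumP : ∑ a, P a = 1 := by
    have : (∑ a, (p a : ℝ)) = n := by exact_mod_cast hp
    simp only [hP, ← Finset.sum_div, this, div_self hn'.ne']
  let C := Finset.univ.image fun y : Fin n → Fin k => symbolCount y
  have hC : (C.card : ℝ) ≤ ((n : ℝ) + 1) ^ k := by
    have h1 : C ⊆ Fintype.piFinset fun _ : Fin k => Finset.range (n + 1) := by
      intro c hc
      obtain ⟨y, -, rfl⟩ := Finset.mem_image.1 hc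
      refine Fintype.mem_piFinset.2 fun a => Finset.mem_range.2 ?_
      have := Finset.single_le_sum (f := symbolCount y) (fun _ _ => Nat.zero_le _)
        (Finset.mem_univ a)
      rw [sum_symbolCount] at this
      omega
    have h2 := Finset.card_le_card h1
    rw [Fintype.card_piFinset] at h2
    simp only [Finset.card_range, Finset.prod_const, Finset.card_univ, Fintype.card_fin] at h2
    exact_mod_cast h2
  -- Pigeonhole: total mass 1 is shared by at most (n+1)^k classes, none heavier than that of `p`.
  calc (1 : ℝ) = ∑ y : Fin n → Fin k, seqProb P y := (sum_seqProb n hsumP).symm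
    _ = ∑ q ∈ C, ∑ y : Fin n → Fin k with symbolCount y = q, seqProb P y :=
        (Finset.sum_fiberwise_of_maps_to
          (fun y _ => Finset.mem_image_of_mem _ (Finset.mem_univ y)) _).symm
    _ ≤ ∑ q ∈ C, ∑ y : Fin n → Fin k with symbolCount y = p, seqProb P y := by
        refine Finset.sum_le_sum fun q hq => ?_
        obtain ⟨y, -, rfl⟩ := Finset.mem_image.1 hq
        exact hle _ (sum_symbolCount y)
    _ = C.card * ∑ y : Fin n → Fin k with symbolCount y = p, seqProb P y := by
        rw [Finset.sum_const, nsmul_eq_mul]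
    _ ≤ _ := mul_le_mul_of_nonneg_right hC
        (Finset.sum_nonneg fun y _ => seqProb_nonneg (fun a => by positivity) y)

/-- Lower bound on the probability of a type class. -/
theorem rpow_le_mul_sum_seqProb_typeClass {k n : ℕ} (hn : n ≠ 0) {Q : Fin k → ℝ}
    (hQ : ∀ a, 0 ≤ Q a) (p : Fin k → ℕ) (hp : ∑ a, p a = n)
    (h : ∀ a, Q a = 0 → p a = 0) :
    (2 : ℝ) ^ (-(n * klReal (fun a => (p a : ℝ) / n) Q)) ≤
      ((n : ℝ) + 1) ^ k * ∑ y : Fin n → Fin k with symbolCount y = p, seqProb Q y := by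
  have hemp : ∀ y : Fin n → Fin k, symbolCount y = p →
      empiricalPmf y = fun a => (p a : ℝ) / n := by
    rintro y rfl
    rfl
  have : ∑ y : Fin n → Fin k with symbolCount y = p, seqProb Q y =
      (2 : ℝ) ^ (-(n * klReal (fun a => (p a : ℝ) / n) Q)) *
      ∑ y : Fin n → Fin k with symbolCount y = p, seqProb (fun a => (p a : ℝ) / n) y := by
    rw [Finset.mul_sum]
    refine Finset.sum_congr rfl fun y hy => ?_
    have hy' := hemp y (Finset.mem_filter.1 hy).2
    rw [← hy']
    refine seqProb_eq_rpow_mul hn hQ fun a ha => ?_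
    rw [hy']
    simp [h a ha]
  rw [this, mul_left_comm]
  exact le_mul_of_one_le_right (by positivity) (one_le_mul_sum_seqProb_typeClass hn p hp)

/-! ### Transportation maps and the north-west corner rule -/

/-- The sign of `L` matters for the zero map, where the supremum of the empty set is 0. -/
theorem maxShipment_le_iff {k : ℕ} (v : Fin k → ℝ) (S : Fin k → Fin k → ℝ) {L : ℝ} (hL : 0 ≤ L) :
    maxShipment v S ≤ L ↔ ∀ i j, S i j ≠ 0 → |v i - v j| ≤ L := by
  have hfin : {d : ℝ | ∃ i j, S i j ≠ 0 ∧ d = |v i - v j|}.Finite := by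
    refine (Set.finite_range fun p : Fin k × Fin k => |v p.1 - v p.2|).subset ?_
    rintro d ⟨i, j, -, rfl⟩
    exact ⟨(i, j), rfl⟩
  constructor
  · exact fun h i j hij => (le_csSup hfin.bddAbove ⟨i, j, hij, rfl⟩).trans h
  · intro h
    refine Real.sSup_le ?_ hL
    rintro d ⟨i, j, hij, rfl⟩
    exact h i j hij

theorem maxShipment_nonneg {k : ℕ} (v : Fin k → ℝ) (S : Fin k → Fin k → ℝ) :
    0 ≤ maxShipment v S := by
  refine Real.sSup_nonneg ?_
  rintro d ⟨i, j, -, rfl⟩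
  exact abs_nonneg _

/-- `S` is a transportation map from `P` to `Q`. -/
structure IsTransport {k : ℕ} (S : Fin k → Fin k → ℝ) (P Q : Fin k → ℝ) : Prop where
  nonneg : ∀ a b, 0 ≤ S a b
  sum_row : ∀ a, ∑ b, S a b = P a
  sum_col : ∀ b, ∑ a, S a b = Q b

theorem IsTransport.swap {k : ℕ} {S : Fin k → Fin k → ℝ} {P Q : Fin k → ℝ}
    (h : IsTransport S P Q) : IsTransport (fun b a => S a b) Q P :=
  ⟨fun b a => h.nonneg a b, h.sum_col, h.sum_row⟩

/-- If nothing is shipped from the bins `≥ a` to the bins `≤ b`, the demand up to `b` is satisfied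
by the supply before `a`. -/
theorem IsTransport.sum_Iic_le_sum_Iio {k : ℕ} {S : Fin k → Fin k → ℝ} {P Q : Fin k → ℝ}
    (h : IsTransport S P Q) {a b : Fin k} (hS : ∀ a' b', a ≤ a' → b' ≤ b → S a' b' = 0) :
    ∑ b' ∈ Finset.Iic b, Q b' ≤ ∑ a' ∈ Finset.Iio a, P a' := by
  calc ∑ b' ∈ Finset.Iic b, Q b' = ∑ b' ∈ Finset.Iic b, ∑ a' ∈ Finset.Iio a, S a' b' := by
        refine Finset.sum_congr rfl fun b' hb' => ?_
        rw [← h.sum_col b']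
        refine (Finset.sum_subset (Finset.subset_univ _) fun a' _ ha' => ?_).symm
        exact hS a' b' (not_lt.1 fun hlt => ha' (Finset.mem_Iio.2 hlt)) (Finset.mem_Iic.1 hb')
    _ = ∑ a' ∈ Finset.Iio a, ∑ b' ∈ Finset.Iic b, S a' b' := Finset.sum_comm
    _ ≤ ∑ a' ∈ Finset.Iio a, P a' := by
        refine Finset.sum_le_sum fun a' _ => ?_
        rw [← h.sum_row a']
        exact Finset.sum_le_univ_sum_of_nonneg fun b' => h.nonneg a' b'

/-- In a partial transport in which the bins before `a` are exhausted, nothing has been shipped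
past `b`, and `b` has unsatisfied demand, the supply before `a` is less than the demand up to
`b`. -/
theorem sum_Iio_lt_sum_Iic_of_partial {k : ℕ} {M : Fin k → Fin k → ℝ} {P Q s d : Fin k → ℝ}
    (hM : ∀ a b, 0 ≤ M a b) (hrow : ∀ a, ∑ b, M a b + s a = P a)
    (hcol : ∀ b, ∑ a, M a b + d b = Q b) (hd : ∀ b, 0 ≤ d b) {a b : Fin k}
    (hs : ∀ a' < a, s a' = 0) (hb : ∀ a' b', M a' b' ≠ 0 → b' ≤ b) (hdb : 0 < d b) :
    ∑ a' ∈ Finset.Iio a, P a' < ∑ b' ∈ Finset.Iic b, Q b' := by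
  calc ∑ a' ∈ Finset.Iio a, P a' = ∑ a' ∈ Finset.Iio a, ∑ b' ∈ Finset.Iic b, M a' b' := by
        refine Finset.sum_congr rfl fun a' ha' => ?_
        rw [← hrow a', hs a' (Finset.mem_Iio.1 ha'), add_zero]
        refine (Finset.sum_subset (Finset.subset_univ _) fun b' _ hb' => ?_).symm
        by_contra hne
        exact hb' (Finset.mem_Iic.2 (hb a' b' hne))
    _ = ∑ b' ∈ Finset.Iic b, ∑ a' ∈ Finset.Iio a, M a' b' := Finset.sum_comm
    _ ≤ ∑ b' ∈ Finset.Iic b, (Q b' - d b') := by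
        refine Finset.sum_le_sum fun b' _ => ?_
        rw [← hcol b', add_sub_cancel_right]
        exact Finset.sum_le_univ_sum_of_nonneg fun a' => hM a' b'
    _ < ∑ b' ∈ Finset.Iic b, Q b' := by
        refine Finset.sum_lt_sum (fun b' _ => by linarith [hd b']) ⟨b, Finset.mem_Iic.2 le_rfl, ?_⟩
        linarith

/-- The invariant of the north-west corner algorithm. -/
structure NWCState.Inv {k : ℕ} (P Q : Fin k → ℝ) (s : NWCState k) : Prop where
  supply_nonneg : ∀ a, 0 ≤ s.supply a
  demand_nonneg : ∀ b, 0 ≤ s.demand b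
  map_nonneg : ∀ a b, 0 ≤ s.map a b
  row : ∀ a, ∑ b, s.map a b + s.supply a = P a
  col : ∀ b, ∑ a, s.map a b + s.demand b = Q b
  supply_eq_zero : ∀ a : Fin k, (a : ℕ) < s.i → s.supply a = 0
  demand_eq_zero : ∀ b : Fin k, (b : ℕ) < s.j → s.demand b = 0
  -- The final disjunction says that the current cell is still empty, so that overwriting it amounts
  -- to adding a shipment.
  bounds : ∀ a b : Fin k, s.map a b ≠ 0 → (a : ℕ) ≤ s.i ∧ (b : ℕ) ≤ s.j ∧ ((a : ℕ) < s.i ∨ (b : ℕ) < s.j)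
  -- Bins `a` and `b`, seen as intervals of cumulative mass, overlap in positive length; optimality
  -- rests on this alone.
  overlap : ∀ a b : Fin k, s.map a b ≠ 0 →
    ∑ a' ∈ Finset.Iio a, P a' < ∑ b' ∈ Finset.Iic b, Q b' ∧
    ∑ b' ∈ Finset.Iio b, Q b' < ∑ a' ∈ Finset.Iic a, P a'

theorem sum_update_of_eq_zero {k : ℕ} (f : Fin k → ℝ) (b : Fin k) (x : ℝ) (h0 : f b = 0) :
    ∑ c, Function.update f b x c = ∑ c, f c + x := by
  rw [Finset.sum_update_of_mem (Finset.mem_univ b),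
    ← Finset.add_sum_erase _ f (Finset.mem_univ b), h0, Finset.sdiff_singleton_eq_erase]
  ring

theorem NWCState.step_of_not {k : ℕ} {s : NWCState k} (h : ¬(s.i < k ∧ s.j < k)) :
    s.step = s := by
  rw [NWCState.step, dif_neg h]

theorem NWCState.Inv.step {k : ℕ} {P Q : Fin k → ℝ} {s : NWCState k} (hs : s.Inv P Q) :
    s.step.Inv P Q := by
  classical
  by_cases h : s.i < k ∧ s.j < k
  swap
  · rwa [NWCState.step_of_not h]
  obtain ⟨i, j, supply, demand, map⟩ := s
  obtain ⟨hsn, hdn, hmn, hrow, hcol, hs0, hd0, hbd, hov⟩ := hs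
  simp only at h hsn hdn hmn hrow hcol hs0 hd0 hbd hov
  simp only [NWCState.step, dif_pos h]
  set a : Fin k := ⟨i, h.1⟩ with ha
  set b : Fin k := ⟨j, h.2⟩ with hb
  set m : ℝ := min (supply a) (demand b) with hm
  have hm0 : 0 ≤ m := le_min (hsn a) (hdn b)
  have hma : m ≤ supply a := min_le_left _ _
  have hmb : m ≤ demand b := min_le_right _ _
  have hor : supply a - m = 0 ∨ demand b - m = 0 := by
    rcases min_choice (supply a) (demand b) with e | e
    · exact Or.inl (by rw [hm, e, sub_self])
    · exact Or.inr (by rw [hm, e, sub_self])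
  have hab : map a b = 0 := by
    by_contra hne
    rcases (hbd a b hne).2.2 with h' | h' <;> exact lt_irrefl _ h'
  set map' := Function.update map a (Function.update (map a) b m) with hmap'
  have hmapab : map' a b = m := by simp [hmap']
  have hmapne : ∀ a' b', ¬(a' = a ∧ b' = b) → map' a' b' = map a' b' := by
    intro a' b' hne
    by_cases ha' : a' = a
    · subst ha'
      have hb' : b' ≠ b := fun e => hne ⟨rfl, e⟩
      simp [hmap', hb']
    · simp [hmap', ha']
  have hval_a : ∀ a' : Fin k, (a' : ℕ) = i → a' = a := fun a' e => Fin.ext e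
  have hval_b : ∀ b' : Fin k, (b' : ℕ) = j → b' = b := fun b' e => Fin.ext e
  refine ⟨?_, ?_, ?_, ?_, ?_, ?_, ?_, ?_, ?_⟩ <;> dsimp only
  · intro a'
    by_cases e : a' = a
    · subst e; simpa using hma
    · simpa [e] using hsn a'
  · intro b'
    by_cases e : b' = b
    · subst e; simpa using hmb
    · simpa [e] using hdn b'
  · intro a' b'
    by_cases e : a' = a ∧ b' = b
    · rw [e.1, e.2, hmapab]; exact hm0
    · rw [hmapne a' b' e]; exact hmn a' b'
  · intro a'
    by_cases e : a' = a
    · subst e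
      have : map' a = Function.update (map a) b m := by simp [hmap']
      rw [this, sum_update_of_eq_zero _ _ _ hab, Function.update_self, ← hrow a]
      ring
    · rw [Function.update_of_ne e, ← hrow a']
      congr 1
      exact Finset.sum_congr rfl fun b' _ => hmapne a' b' fun h => e h.1
  · intro b'
    by_cases e : b' = b
    · subst e
      have : (fun a' => map' a' b) = Function.update (fun a' => map a' b) a m := by
        funext a'
        by_cases e : a' = a
        · subst e; simp [hmapab]
        · rw [Function.update_of_ne e, hmapne a' b fun h => e h.1]
      have h2 : ∑ a', map' a' b = ∑ a', map a' b + m := by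
        rw [← sum_update_of_eq_zero (fun a' => map a' b) a m hab, ← this]
      rw [h2, Function.update_self, ← hcol b]
      ring
    · rw [Function.update_of_ne e, ← hcol b']
      congr 1
      exact Finset.sum_congr rfl fun a' _ => hmapne a' b' fun h => e h.2
  · intro a' ha'
    by_cases e : a' = a
    · subst e
      rw [Function.update_self]
      by_contra hne
      rw [if_neg hne] at ha'
      exact lt_irrefl _ ha'
    · rw [Function.update_of_ne e]
      refine hs0 a' ?_
      have hne : (a' : ℕ) ≠ i := fun e' => e (hval_a a' e')
      split_ifs at ha' <;> omega
  · intro b' hb'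
    by_cases e : b' = b
    · subst e
      rw [Function.update_self]
      by_contra hne
      rw [if_neg hne] at hb'
      exact lt_irrefl _ hb'
    · rw [Function.update_of_ne e]
      refine hd0 b' ?_
      have hne : (b' : ℕ) ≠ j := fun e' => e (hval_b b' e')
      split_ifs at hb' <;> omega
  · intro a' b' hne
    by_cases e : a' = a ∧ b' = b
    · have h1 : (a' : ℕ) = i := by rw [e.1]
      have h2 : (b' : ℕ) = j := by rw [e.2]
      rcases hor with h0 | h0
      · rw [if_pos h0]; split_ifs <;> omega
      · rw [if_pos h0]; split_ifs <;> omega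
    · rw [hmapne a' b' e] at hne
      have := hbd a' b' hne
      split_ifs <;> omega
  · intro a' b' hne
    by_cases e : a' = a ∧ b' = b
    · rw [e.1, e.2] at hne ⊢
      rw [hmapab] at hne
      have hmpos : 0 < m := lt_of_le_of_ne hm0 (Ne.symm hne)
      constructor
      -- A positive shipment means that both current bins were nonempty beforehand; the state before
      -- the step gives one inequality, and its transpose the other.
      · exact sum_Iio_lt_sum_Iic_of_partial hmn hrow hcol hdn (fun a' ha' => hs0 a' ha')
          (fun a' b' hne' => (hbd a' b' hne').2.1) (hmpos.trans_le hmb)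
      · exact sum_Iio_lt_sum_Iic_of_partial (M := fun b' a' => map a' b') (fun b' a' => hmn a' b')
          hcol hrow hsn (fun b' hb' => hd0 b' hb')
          (fun b' a' hne' => (hbd a' b' hne').1) (hmpos.trans_le hma)
    · rw [hmapne a' b' e] at hne
      exact hov a' b' hne

/-- The minimum equals the supply or the demand, so at least one of the two bins is passed. -/
theorem NWCState.step_progress {k : ℕ} (s : NWCState k) (h : s.i < k ∧ s.j < k) :
    s.i + s.j + 1 ≤ s.step.i + s.step.j := by
  simp only [NWCState.step, dif_pos h]
  rcases min_choice (s.supply ⟨s.i, h.1⟩) (s.demand ⟨s.j, h.2⟩) with e | e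
  · rw [e, sub_self, if_pos rfl]
    split_ifs <;> omega
  · rw [e, sub_self, if_pos rfl]
    split_ifs <;> omega

theorem NWCState.iterate_step_progress {k : ℕ} (s : NWCState k) (t : ℕ) :
    t ≤ (NWCState.step^[t] s).i + (NWCState.step^[t] s).j ∨
      ¬((NWCState.step^[t] s).i < k ∧ (NWCState.step^[t] s).j < k) := by
  induction t with
  | zero => exact Or.inl (Nat.zero_le _)
  | succ t ih =>
    rw [Function.iterate_succ_apply']
    by_cases h : (NWCState.step^[t] s).i < k ∧ (NWCState.step^[t] s).j < k
    · left
      have := NWCState.step_progress _ h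
      rcases ih with ih | ih
      · omega
      · exact absurd h ih
    · right
      rwa [NWCState.step_of_not h]

theorem NWCState.Inv.iterate {k : ℕ} {P Q : Fin k → ℝ} {s : NWCState k} (hs : s.Inv P Q) (t : ℕ) :
    (NWCState.step^[t] s).Inv P Q := by
  induction t with
  | zero => exact hs
  | succ t ih =>
    rw [Function.iterate_succ_apply']
    exact ih.step

/-- The north-west corner map is a transportation map, and it ships only between overlapping bins
of the two cumulative distributions. -/
theorem isTransport_nwcMap {k : ℕ} {P Q : Fin k → ℝ} (hP : P ∈ stdSimplex ℝ (Fin k))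
    (hQ : Q ∈ stdSimplex ℝ (Fin k)) :
    IsTransport (nwcMap P Q) P Q ∧ ∀ a b : Fin k, nwcMap P Q a b ≠ 0 →
      ∑ a' ∈ Finset.Iio a, P a' < ∑ b' ∈ Finset.Iic b, Q b' ∧
      ∑ b' ∈ Finset.Iio b, Q b' < ∑ a' ∈ Finset.Iic a, P a' := by
  have hinit : (⟨0, 0, P, Q, fun _ _ => 0⟩ : NWCState k).Inv P Q := by
    constructor <;> intros <;> first | exact hP.1 _ | exact hQ.1 _ | simp_all
  have hinv := hinit.iterate (2 * k)
  have hprog := NWCState.iterate_step_progress (⟨0, 0, P, Q, fun _ _ => 0⟩ : NWCState k) (2 * k)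
  rw [nwcMap]
  set s := NWCState.step^[2 * k] (⟨0, 0, P, Q, fun _ _ => 0⟩ : NWCState k)
  -- Leftover supply and leftover demand always balance, so exhausting one side exhausts the other.
  have hsum : ∑ a, s.supply a = ∑ b, s.demand b := by
    have h1 : ∑ a, ∑ b, s.map a b + ∑ a, s.supply a = 1 := by
      rw [← Finset.sum_add_distrib, Finset.sum_congr rfl fun a _ => hinv.row a, hP.2]
    have h2 : ∑ b, ∑ a, s.map a b + ∑ b, s.demand b = 1 := by
      rw [← Finset.sum_add_distrib, Finset.sum_congr rfl fun b _ => hinv.col b, hQ.2]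
    rw [Finset.sum_comm] at h2
    linarith
  have hzero : (∑ a, s.supply a = 0) ∧ (∑ b, s.demand b = 0) := by
    -- While both indices are below `k` their sum is below `2 * k`, which bounds the number of
    -- effective steps.
    have : k ≤ s.i ∨ k ≤ s.j := by
      by_contra hcon
      rcases hprog with h | h <;> omega
    rcases this with h | h
    · have : ∑ a, s.supply a = 0 :=
        Finset.sum_eq_zero fun a _ => hinv.supply_eq_zero a (a.isLt.trans_le h)
      exact ⟨this, hsum ▸ this⟩
    · have : ∑ b, s.demand b = 0 :=
        Finset.sum_eq_zero fun b _ => hinv.demand_eq_zero b (b.isLt.trans_le h)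
      exact ⟨hsum.trans this, this⟩
  have hsup : ∀ a, s.supply a = 0 := fun a =>
    (Finset.sum_eq_zero_iff_of_nonneg fun a _ => hinv.supply_nonneg a).1 hzero.1 a
      (Finset.mem_univ a)
  have hdem : ∀ b, s.demand b = 0 := fun b =>
    (Finset.sum_eq_zero_iff_of_nonneg fun b _ => hinv.demand_nonneg b).1 hzero.2 b
      (Finset.mem_univ b)
  refine ⟨⟨hinv.map_nonneg, fun a => ?_, fun b => ?_⟩, hinv.overlap⟩
  · rw [← hinv.row a, hsup a, add_zero]
  · rw [← hinv.col b, hdem b, add_zero]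

/-- The north-west corner map minimizes the maximum shipment distance. -/
theorem maxShipment_nwcMap_le_iff {k : ℕ} {v : Fin k → ℝ} (hv : StrictMono v) {P Q : Fin k → ℝ}
    (hP : P ∈ stdSimplex ℝ (Fin k)) (hQ : Q ∈ stdSimplex ℝ (Fin k)) {L : ℝ} (hL : 0 ≤ L) :
    maxShipment v (nwcMap P Q) ≤ L ↔
      ∃ S, IsTransport S P Q ∧ ∀ i j, S i j ≠ 0 → |v i - v j| ≤ L := by
  obtain ⟨htr, hov⟩ := isTransport_nwcMap hP hQ
  constructor
  · exact fun h => ⟨_, htr, (maxShipment_le_iff v _ hL).1 h⟩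
  · rintro ⟨S, hS, hSL⟩
    rw [maxShipment_le_iff v _ hL]
    intro a b hab
    obtain ⟨h1, h2⟩ := hov a b hab
    refine abs_le.2 ⟨?_, ?_⟩
    -- If `v b` exceeds `v a` by more than `L`, monotonicity of `v` forbids `S` to ship from any bin
    -- up to `a` to any bin from `b` on. The supply up to `a` then fits in the demand before `b`,
    -- against the overlap. The other case is symmetric.
    · by_contra! hlt
      refine (hS.swap.sum_Iic_le_sum_Iio (a := b) (b := a) ?_).not_gt h2
      intro b' a' hb' ha'
      by_contra hne
      have := (abs_le.1 (hSL a' b' hne)).1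
      have := hv.monotone hb'
      have := hv.monotone ha'
      linarith
    · by_contra! hlt
      refine (hS.sum_Iic_le_sum_Iio (a := a) (b := b) ?_).not_gt h1
      intro a' b' ha' hb'
      by_contra hne
      have := (abs_le.1 (hSL a' b' hne)).2
      have := hv.monotone hb'
      have := hv.monotone ha'
      linarith

/-! ### Properties of the divergence -/

theorem klBits_eq_coe {k : ℕ} {P Q : Fin k → ℝ} (h : ∀ a, Q a = 0 → P a = 0) :
    klBits P Q = ((klReal P Q : ℝ) : EReal) := by
  rw [klBits, if_pos h, klReal]

theorem eq_zero_of_klBits_ne_top {k : ℕ} {P Q : Fin k → ℝ} (h : klBits P Q ≠ ⊤) :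
    ∀ a, Q a = 0 → P a = 0 := by
  by_contra hcon
  exact h (by rw [klBits, if_neg hcon])

theorem klBits_self {k : ℕ} (P : Fin k → ℝ) : klBits P P = 0 := by
  rw [klBits_eq_coe fun _ h => h, klReal, Finset.sum_eq_zero, EReal.coe_zero]
  intro a _
  by_cases h : P a = 0
  · simp [h]
  · simp [div_self h]

/-- Each term becomes a rescaled t log t, which is continuous and convex on [0, ∞); at `q = 0` both
sides vanish by the convention for division by zero. -/
theorem mul_logb_div_eq (x q : ℝ) :
    x * Real.logb 2 (x / q) = q / Real.log 2 * ((x / q) * Real.log (x / q)) := by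
  by_cases hq : q = 0
  · simp [hq]
  · rw [Real.logb]
    field_simp

theorem continuous_klReal {k : ℕ} (Q : Fin k → ℝ) : Continuous fun P => klReal P Q := by
  unfold klReal
  refine continuous_finsetSum _ fun a _ => ?_
  simp_rw [mul_logb_div_eq]
  exact continuous_const.mul
    (Real.continuous_mul_log.comp (by fun_prop : Continuous fun P : Fin k → ℝ => P a / Q a))

theorem klReal_convex {k : ℕ} {P P' Q : Fin k → ℝ} (hP : ∀ a, 0 ≤ P a) (hP' : ∀ a, 0 ≤ P' a)
    (hQ : ∀ a, 0 ≤ Q a) {s t : ℝ} (hs : 0 ≤ s) (ht : 0 ≤ t) (hst : s + t = 1) :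
    klReal (s • P + t • P') Q ≤ s * klReal P Q + t * klReal P' Q := by
  unfold klReal
  rw [Finset.mul_sum, Finset.mul_sum, ← Finset.sum_add_distrib]
  refine Finset.sum_le_sum fun a _ => ?_
  have h := Real.convexOn_mul_log.2 (Set.mem_Ici.2 (div_nonneg (hP a) (hQ a)))
    (Set.mem_Ici.2 (div_nonneg (hP' a) (hQ a))) hs ht hst
  simp only [smul_eq_mul] at h
  have e : (s • P + t • P') a / Q a = s * (P a / Q a) + t * (P' a / Q a) := by
    simp only [Pi.add_apply, Pi.smul_apply, smul_eq_mul]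
    ring
  simp_rw [mul_logb_div_eq, e]
  have h2 := mul_le_mul_of_nonneg_left h (div_nonneg (hQ a) (Real.log_nonneg one_le_two))
  linarith

/-- Gibbs' inequality, with its equality case. -/
theorem eq_of_klReal_nonpos {k : ℕ} {P Q : Fin k → ℝ} (hP : P ∈ stdSimplex ℝ (Fin k))
    (hQ : Q ∈ stdSimplex ℝ (Fin k)) (h : ∀ a, Q a = 0 → P a = 0) (hle : klReal P Q ≤ 0) :
    P = Q := by
  have hl2 : 0 < Real.log 2 := Real.log_pos one_lt_two
  -- From log t < t - 1 for t ≠ 1; the lower bounds sum to zero, so one strict term makes the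
  -- divergence positive.
  have hterm : ∀ a, P a ≠ Q a → (P a - Q a) / Real.log 2 < P a * Real.logb 2 (P a / Q a) := by
    intro a hne
    have hQa : 0 < Q a := by
      refine lt_of_le_of_ne (hQ.1 a) fun e => hne ?_
      rw [h a e.symm, ← e]
    rw [Real.logb, ← mul_div_assoc]
    refine div_lt_div_of_pos_right ?_ hl2
    rcases (hP.1 a).eq_or_lt with e | hPa
    · rw [← e]; simpa using hQa
    · have h1 : Real.log (Q a / P a) < Q a / P a - 1 :=
        Real.log_lt_sub_one_of_pos (div_pos hQa hPa) fun e => hne ((div_eq_one_iff_eq hPa.ne').1 e).symm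
      have h2 : Real.log (P a / Q a) = -Real.log (Q a / P a) := by
        rw [← Real.log_inv, inv_div]
      rw [h2]
      have h3 := mul_lt_mul_of_pos_left h1 hPa
      have h4 : P a * (Q a / P a - 1) = Q a - P a := by field_simp
      linarith
  by_contra hne
  obtain ⟨a, ha⟩ := Function.ne_iff.1 hne
  have : ∑ a, (P a - Q a) / Real.log 2 < klReal P Q := by
    refine Finset.sum_lt_sum (fun b _ => ?_) ⟨a, Finset.mem_univ a, hterm a ha⟩
    by_cases hb : P b = Q b
    · rw [hb, sub_self, zero_div]
      by_cases h0 : Q b = 0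
      · simp [h0]
      · simp [div_self h0]
    · exact (hterm b hb).le
  rw [← Finset.sum_div, Finset.sum_sub_distrib, hP.2, hQ.2, sub_self, zero_div] at this
  linarith

/-! ### The optimization problem for the error exponent -/

/-- The input marginal of a transportation map. -/
def inputMarginal {k : ℕ} (S : Fin k → Fin k → ℝ) : Fin k → ℝ := fun i => ∑ j, S i j

/-- Transportation maps of pmfs with shipments over distances at most `L`, out of the support of
`PY` and into the support of `PX`. -/
def feasibleMaps {k : ℕ} (v PX PY : Fin k → ℝ) (L : ℝ) : Set (Fin k → Fin k → ℝ) :=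
  {S | (∀ i j, 0 ≤ S i j) ∧ ∑ i, ∑ j, S i j = 1 ∧
    ∀ i j, (L < |v i - v j| ∨ PY i = 0 ∨ PX j = 0) → S i j = 0}

/-- The error exponent, as the value of an optimization problem. -/
noncomputable def limitExponent {k : ℕ} (v PX PY : Fin k → ℝ) (L lam : ℝ) : EReal :=
  sInf ((fun S => ((klReal (inputMarginal S) PY : ℝ) : EReal)) ''
    {S | S ∈ feasibleMaps v PX PY L ∧ klReal (outputMarginal S) PX < lam})

section

variable {k : ℕ} {v PX PY : Fin k → ℝ} {L : ℝ}

theorem continuous_inputMarginal :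
    Continuous (inputMarginal : (Fin k → Fin k → ℝ) → Fin k → ℝ) := by
  unfold inputMarginal
  fun_prop

theorem continuous_outputMarginal :
    Continuous (outputMarginal : (Fin k → Fin k → ℝ) → Fin k → ℝ) := by
  unfold outputMarginal
  fun_prop

theorem inputMarginal_combo (S T : Fin k → Fin k → ℝ) (s t : ℝ) :
    inputMarginal (s • S + t • T) = s • inputMarginal S + t • inputMarginal T := by
  funext i
  simp [inputMarginal, Finset.sum_add_distrib, Finset.mul_sum]

theorem outputMarginal_combo (S T : Fin k → Fin k → ℝ) (s t : ℝ) :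
    outputMarginal (s • S + t • T) = s • outputMarginal S + t • outputMarginal T := by
  funext i
  simp [outputMarginal, Finset.sum_add_distrib, Finset.mul_sum]

theorem inputMarginal_mem_stdSimplex {S : Fin k → Fin k → ℝ} (h : S ∈ feasibleMaps v PX PY L) :
    inputMarginal S ∈ stdSimplex ℝ (Fin k) :=
  ⟨fun i => Finset.sum_nonneg fun j _ => h.1 i j, h.2.1⟩

theorem outputMarginal_mem_stdSimplex {S : Fin k → Fin k → ℝ} (h : S ∈ feasibleMaps v PX PY L) :
    outputMarginal S ∈ stdSimplex ℝ (Fin k) :=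
  ⟨fun j => Finset.sum_nonneg fun i _ => h.1 i j, by
    simp only [outputMarginal]; rw [Finset.sum_comm]; exact h.2.1⟩

theorem inputMarginal_eq_zero {S : Fin k → Fin k → ℝ} (h : S ∈ feasibleMaps v PX PY L) (i : Fin k)
    (hi : PY i = 0) : inputMarginal S i = 0 :=
  Finset.sum_eq_zero fun j _ => h.2.2 i j (Or.inr (Or.inl hi))

theorem outputMarginal_eq_zero {S : Fin k → Fin k → ℝ} (h : S ∈ feasibleMaps v PX PY L) (j : Fin k)
    (hj : PX j = 0) : outputMarginal S j = 0 :=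
  Finset.sum_eq_zero fun i _ => h.2.2 i j (Or.inr (Or.inr hj))

theorem isCompact_feasibleMaps : IsCompact (feasibleMaps v PX PY L) := by
  have hbox : IsCompact (Set.univ.pi fun _ : Fin k => Set.univ.pi fun _ : Fin k =>
      Set.Icc (0 : ℝ) 1) := isCompact_univ_pi fun _ => isCompact_univ_pi fun _ => isCompact_Icc
  refine hbox.of_isClosed_subset ?_ ?_
  · have e : feasibleMaps v PX PY L = (⋂ i, ⋂ j, {S : Fin k → Fin k → ℝ | 0 ≤ S i j}) ∩
        ({S | ∑ i, ∑ j, S i j = 1} ∩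
        ⋂ i, ⋂ j, ⋂ _ : (L < |v i - v j| ∨ PY i = 0 ∨ PX j = 0), {S | S i j = 0}) := by
      ext S
      simp [feasibleMaps]
    rw [e]
    refine IsClosed.inter ?_ (IsClosed.inter ?_ ?_)
    · exact isClosed_iInter fun i => isClosed_iInter fun j =>
        isClosed_le continuous_const (by fun_prop)
    · exact isClosed_eq (by fun_prop) continuous_const
    · exact isClosed_iInter fun i => isClosed_iInter fun j => isClosed_iInter fun _ =>
        isClosed_eq (by fun_prop) continuous_const
  · intro S hS i _ j _
    refine ⟨hS.1 i j, ?_⟩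
    rw [← hS.2.1]
    calc S i j ≤ ∑ j, S i j :=
          Finset.single_le_sum (f := fun j => S i j) (fun j _ => hS.1 i j) (Finset.mem_univ j)
      _ ≤ ∑ i, ∑ j, S i j :=
          Finset.single_le_sum (f := fun i => ∑ j, S i j)
            (fun i _ => Finset.sum_nonneg fun j _ => hS.1 i j) (Finset.mem_univ i)

theorem feasibleMaps_combo {S T : Fin k → Fin k → ℝ} (hS : S ∈ feasibleMaps v PX PY L)
    (hT : T ∈ feasibleMaps v PX PY L) {s t : ℝ} (hs : 0 ≤ s) (ht : 0 ≤ t) (hst : s + t = 1) :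
    s • S + t • T ∈ feasibleMaps v PX PY L := by
  refine ⟨fun i j => ?_, ?_, fun i j hij => ?_⟩
  · have := hS.1 i j
    have := hT.1 i j
    simp only [Pi.add_apply, Pi.smul_apply, smul_eq_mul]
    positivity
  · simp only [Pi.add_apply, Pi.smul_apply, smul_eq_mul, Finset.sum_add_distrib, ← Finset.mul_sum]
    rw [hS.2.1, hT.2.1, mul_one, mul_one, hst]
  · simp [hS.2.2 i j hij, hT.2.2 i j hij]

theorem limitExponent_le {S : Fin k → Fin k → ℝ} {lam : ℝ} (hS : S ∈ feasibleMaps v PX PY L)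
    (h : klReal (outputMarginal S) PX < lam) :
    limitExponent v PX PY L lam ≤ ((klReal (inputMarginal S) PY : ℝ) : EReal) :=
  sInf_le ⟨S, ⟨hS, h⟩, rfl⟩

theorem le_limitExponent {lam c : ℝ} (h : ∀ S ∈ feasibleMaps v PX PY L,
    klReal (outputMarginal S) PX < lam → c ≤ klReal (inputMarginal S) PY) :
    (c : EReal) ≤ limitExponent v PX PY L lam := by
  refine le_sInf ?_
  rintro _ ⟨S, ⟨hS, hlam⟩, rfl⟩
  exact EReal.coe_le_coe_iff.2 (h S hS hlam)

theorem exists_of_limitExponent_lt {lam : ℝ} {a : EReal} (h : limitExponent v PX PY L lam < a) :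
    ∃ S ∈ feasibleMaps v PX PY L, klReal (outputMarginal S) PX < lam ∧
      ((klReal (inputMarginal S) PY : ℝ) : EReal) < a := by
  obtain ⟨_, ⟨S, ⟨hS, hlam⟩, rfl⟩, ha⟩ := sInf_lt_iff.1 h
  exact ⟨S, hS, hlam, ha⟩

/-- The error exponent is lower semicontinuous from the right at all small `lam`. -/
theorem eventually_exists_gt_forall_le (hPX : ∀ a, 0 ≤ PX a) (hPY : ∀ a, 0 ≤ PY a) :
    ∀ᶠ lam in 𝓝[>] (0 : ℝ), ∀ c : ℝ, (c : EReal) < limitExponent v PX PY L lam →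
      ∃ ν > lam, ∀ S ∈ feasibleMaps v PX PY L, klReal (outputMarginal S) PX < ν →
        c ≤ klReal (inputMarginal S) PY := by
  -- Right semicontinuity can fail at a positive minimum of the output divergence, where the strict
  -- constraint first becomes feasible. Either there is no such threshold, or it suffices to stay
  -- below it.
  by_cases hne : ∀ lam > 0, ∃ S ∈ feasibleMaps v PX PY L, klReal (outputMarginal S) PX < lam
  · filter_upwards [self_mem_nhdsWithin] with lam hlam c hc
    obtain ⟨S₀, hS₀, hg⟩ := hne lam hlam
    obtain ⟨c', hcc', hc'⟩ := EReal.lt_iff_exists_real_btwn.1 hc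
    have hcc' : c < c' := EReal.coe_lt_coe_iff.1 hcc'
    set g₀ := klReal (outputMarginal S₀) PX
    set f₀ := klReal (inputMarginal S₀) PY
    obtain ⟨t, ht0, ht1, htc⟩ : ∃ t : ℝ, 0 < t ∧ t < 1 ∧ (1 - t) * c + t * f₀ < c' := by
      have hcont : Tendsto (fun t : ℝ => (1 - t) * c + t * f₀) (𝓝[>] 0) (𝓝 c) := by
        have : Continuous fun t : ℝ => (1 - t) * c + t * f₀ := by fun_prop
        simpa using (this.tendsto 0).mono_left nhdsWithin_le_nhds
      obtain ⟨t, ht, h0, h1⟩ := ((hcont.eventually_lt_const hcc').and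
        (Ioo_mem_nhdsGT (zero_lt_one' ℝ))).exists
      exact ⟨t, h0, h1, ht⟩
    -- Mixing `S` with weight `t` of the strictly interior `S₀` brings an output divergence below
    -- this ν down to less than lam - t²(lam - g₀), while the input divergence stays below `c'`.
    refine ⟨lam + t * (lam - g₀), by nlinarith [mul_pos ht0 (sub_pos.2 hg)], fun S hS hSν => ?_⟩
    by_contra! hfc
    have hT := feasibleMaps_combo hS hS₀ (sub_nonneg.2 ht1.le) ht0.le (by ring)
    have h1 := klReal_convex (outputMarginal_mem_stdSimplex hS).1
      (outputMarginal_mem_stdSimplex hS₀).1 hPX (sub_nonneg.2 ht1.le) ht0.le (by ring)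
    have h2 := klReal_convex (inputMarginal_mem_stdSimplex hS).1
      (inputMarginal_mem_stdSimplex hS₀).1 hPY (sub_nonneg.2 ht1.le) ht0.le (by ring)
    rw [← outputMarginal_combo] at h1
    rw [← inputMarginal_combo] at h2
    have hglam : klReal (outputMarginal ((1 - t) • S + t • S₀)) PX < lam := by
      have h3 := mul_lt_mul_of_pos_left hSν (sub_pos.2 ht1)
      have h4 : 0 < t * t * (lam - g₀) := mul_pos (mul_pos ht0 ht0) (sub_pos.2 hg)
      change _ ≤ _ + t * g₀ at h1
      nlinarith
    have h5 := hc'.trans_le (limitExponent_le hT hglam)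
    have h6 : c' < _ := EReal.coe_lt_coe_iff.1 h5
    have h7 := mul_lt_mul_of_pos_left hfc (sub_pos.2 ht1)
    change _ ≤ _ + t * f₀ at h2
    linarith
  · push Not at hne
    obtain ⟨lam₀, hlam₀, hno⟩ := hne
    filter_upwards [Ioo_mem_nhdsGT hlam₀] with lam hlam c _
    -- Below `lam₀` the constraint is infeasible, so the bound is vacuous.
    exact ⟨lam₀, hlam.2, fun S hS hSl => absurd hSl (hno S hS).not_gt⟩

/-- By optimality of the north-west corner map, Γ is a projection of a set of transportation maps,
to which linear and compactness arguments apply. -/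
theorem mem_smallestRegion_iff (hv : StrictMono v) (hPX : PX ∈ stdSimplex ℝ (Fin k)) (hL : 0 ≤ L)
    {P : Fin k → ℝ} : P ∈ smallestRegion v PX L ↔
      ∃ S, IsTransport S P PX ∧ ∀ i j, S i j ≠ 0 → |v i - v j| ≤ L := by
  constructor
  · rintro ⟨hP, h⟩
    exact (maxShipment_nwcMap_le_iff hv hP hPX hL).1 h
  · rintro ⟨S, hS, hSL⟩
    have hP : P ∈ stdSimplex ℝ (Fin k) := by
      refine ⟨fun a => ?_, ?_⟩
      · rw [← hS.sum_row a]
        exact Finset.sum_nonneg fun b _ => hS.nonneg a b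
      · rw [← hPX.2, ← Finset.sum_congr rfl fun a _ => hS.sum_row a, Finset.sum_comm]
        exact Finset.sum_congr rfl fun b _ => hS.sum_col b
    exact ⟨hP, (maxShipment_nwcMap_le_iff hv hP hPX hL).2 ⟨S, hS, hSL⟩⟩

theorem inputMarginal_mem_smallestRegion (hv : StrictMono v) (hPX : PX ∈ stdSimplex ℝ (Fin k))
    (hL : 0 ≤ L) {S : Fin k → Fin k → ℝ} (hS : S ∈ feasibleMaps v PX PY L)
    (h : outputMarginal S = PX) : inputMarginal S ∈ smallestRegion v PX L := by
  refine (mem_smallestRegion_iff hv hPX hL).2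
    ⟨S, ⟨hS.1, fun a => rfl, fun b => congrFun h b⟩, fun i j hij => ?_⟩
  by_contra! hlt
  exact hij (hS.2.2 i j (Or.inl hlt))

theorem exists_feasibleMap_of_mem_smallestRegion (hv : StrictMono v)
    (hPX : PX ∈ stdSimplex ℝ (Fin k)) (hL : 0 ≤ L) {P : Fin k → ℝ}
    (hP : P ∈ smallestRegion v PX L) (h : ∀ a, PY a = 0 → P a = 0) :
    ∃ S ∈ feasibleMaps v PX PY L, inputMarginal S = P ∧ outputMarginal S = PX := by
  obtain ⟨S, hS, hSL⟩ := (mem_smallestRegion_iff hv hPX hL).1 hP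
  refine ⟨S, ⟨hS.nonneg, ?_, ?_⟩, funext hS.sum_row, funext hS.sum_col⟩
  · rw [Finset.sum_congr rfl fun a _ => hS.sum_row a]
    exact hP.1.2
  · rintro i j (hij | hi | hj)
    · by_contra hne
      exact (hSL i j hne).not_gt hij
    · exact (Finset.sum_eq_zero_iff_of_nonneg fun j _ => hS.nonneg i j).1
        ((hS.sum_row i).trans (h i hi)) j (Finset.mem_univ j)
    · exact (Finset.sum_eq_zero_iff_of_nonneg fun i _ => hS.nonneg i j).1
        ((hS.sum_col j).trans hj) i (Finset.mem_univ i)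

theorem self_mem_smallestRegion (hv : StrictMono v) (hPX : PX ∈ stdSimplex ℝ (Fin k))
    (hL : 0 ≤ L) : PX ∈ smallestRegion v PX L := by
  classical
  refine (mem_smallestRegion_iff hv hPX hL).2
    ⟨fun i j => if i = j then PX i else 0, ⟨fun i j => ?_, fun i => by simp, fun j => by simp⟩,
      fun i j hij => ?_⟩
  · split_ifs
    exacts [hPX.1 i, le_rfl]
  · by_cases e : i = j
    · simpa [e] using hL
    · simp [e] at hij

/-- The minimum is taken over the compact set of feasible maps with output `PX`, on which the
divergence is real and continuous. If that set is empty, the divergence is infinite on all of Γ and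
any point, such as `PX`, is a minimizer. -/
theorem exists_isMinOn_smallestRegion (hv : StrictMono v) (hPX : PX ∈ stdSimplex ℝ (Fin k))
    (hL : 0 ≤ L) :
    ∃ P₀ ∈ smallestRegion v PX L, IsMinOn (fun P => klBits P PY) (smallestRegion v PX L) P₀ := by
  by_cases hne : {S | S ∈ feasibleMaps v PX PY L ∧ outputMarginal S = PX}.Nonempty
  · have hcomp : IsCompact {S | S ∈ feasibleMaps v PX PY L ∧ outputMarginal S = PX} :=
      isCompact_feasibleMaps.inter_right (isClosed_eq continuous_outputMarginal continuous_const)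
    obtain ⟨S₀, hS₀, hmin⟩ := hcomp.exists_isMinOn hne
      ((continuous_klReal PY).comp continuous_inputMarginal).continuousOn
    refine ⟨_, inputMarginal_mem_smallestRegion hv hPX hL hS₀.1 hS₀.2, fun P hP => ?_⟩
    change klBits _ PY ≤ klBits P PY
    by_cases htop : klBits P PY = ⊤
    · rw [htop]; exact le_top
    · have h0 := eq_zero_of_klBits_ne_top htop
      obtain ⟨S, hS, rfl, hSX⟩ := exists_feasibleMap_of_mem_smallestRegion hv hPX hL hP h0
      rw [klBits_eq_coe h0, klBits_eq_coe (inputMarginal_eq_zero hS₀.1)]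
      exact EReal.coe_le_coe_iff.2 (hmin ⟨hS, hSX⟩)
  · refine ⟨PX, self_mem_smallestRegion hv hPX hL, fun P hP => ?_⟩
    have htop : klBits P PY = ⊤ := by
      by_contra htop
      obtain ⟨S, hS, -, hSX⟩ := exists_feasibleMap_of_mem_smallestRegion hv hPX hL hP
        (eq_zero_of_klBits_ne_top htop)
      exact hne ⟨S, hS, hSX⟩
    change _ ≤ klBits P PY
    rw [htop]
    exact le_top

/-- Lower bound: for c below the minimum, the feasible maps with input divergence at most c form a
compact set on which the output divergence has a positive minimum, since by Gibbs the value zero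
would give a point of Γ beating `P₀`. Upper bound: a map from `P₀` to `PX` is feasible for every λ >
0. -/
theorem tendsto_limitExponent (hv : StrictMono v) (hPX : PX ∈ stdSimplex ℝ (Fin k)) (hL : 0 ≤ L)
    {P₀ : Fin k → ℝ} (hP₀ : P₀ ∈ smallestRegion v PX L)
    (hmin : IsMinOn (fun P => klBits P PY) (smallestRegion v PX L) P₀) :
    Tendsto (limitExponent v PX PY L) (𝓝[>] (0 : ℝ)) (𝓝 (klBits P₀ PY)) := by
  refine tendsto_order.2 ⟨fun a ha => ?_, fun a ha => ?_⟩
  · obtain ⟨c, hac, hc⟩ := EReal.lt_iff_exists_real_btwn.1 ha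
    obtain ⟨lam₀, hlam₀, h⟩ : ∃ lam₀ > 0, ∀ S ∈ feasibleMaps v PX PY L,
        klReal (outputMarginal S) PX < lam₀ → c ≤ klReal (inputMarginal S) PY := by
      by_cases hne : {S | S ∈ feasibleMaps v PX PY L ∧ klReal (inputMarginal S) PY ≤ c}.Nonempty
      · have hcomp : IsCompact
            {S | S ∈ feasibleMaps v PX PY L ∧ klReal (inputMarginal S) PY ≤ c} :=
          isCompact_feasibleMaps.inter_right (isClosed_le
            ((continuous_klReal PY).comp continuous_inputMarginal) continuous_const)
        obtain ⟨S₁, hS₁, hmin₁⟩ := hcomp.exists_isMinOn hne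
          ((continuous_klReal PX).comp continuous_outputMarginal).continuousOn
        refine ⟨klReal (outputMarginal S₁) PX, ?_, fun S hS hlt => ?_⟩
        · by_contra! hle
          have hX := eq_of_klReal_nonpos (outputMarginal_mem_stdSimplex hS₁.1) hPX
            (outputMarginal_eq_zero hS₁.1) hle
          have h1 : klBits P₀ PY ≤ klBits (inputMarginal S₁) PY :=
            hmin (inputMarginal_mem_smallestRegion hv hPX hL hS₁.1 hX)
          rw [klBits_eq_coe (inputMarginal_eq_zero hS₁.1)] at h1
          exact (hc.trans_le h1).not_ge (EReal.coe_le_coe_iff.2 hS₁.2)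
        · by_contra! hlt'
          exact (hmin₁ ⟨hS, hlt'.le⟩ : klReal (outputMarginal S₁) PX ≤ _).not_gt hlt
      · refine ⟨1, one_pos, fun S hS _ => ?_⟩
        by_contra! hlt
        exact hne ⟨S, hS, hlt.le⟩
    filter_upwards [Ioo_mem_nhdsGT hlam₀] with lam hlam
    exact hac.trans_le (le_limitExponent fun S hS hSl => h S hS (hSl.trans hlam.2))
  · filter_upwards [self_mem_nhdsWithin] with lam hlam
    refine lt_of_le_of_lt ?_ ha
    by_cases htop : klBits P₀ PY = ⊤
    · rw [htop]; exact le_top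
    · have h0 := eq_zero_of_klBits_ne_top htop
      obtain ⟨S, hS, rfl, hSX⟩ := exists_feasibleMap_of_mem_smallestRegion hv hPX hL hP₀ h0
      rw [klBits_eq_coe h0]
      refine limitExponent_le hS ?_
      have h1 := klBits_self PX
      rw [klBits_eq_coe fun _ h => h, EReal.coe_eq_zero] at h1
      rw [hSX, h1]
      exact hlam

end

/-! ### Asymptotics of the error probabilities -/

theorem tendsto_mul_logb_div (k : ℕ) :
    Tendsto (fun n : ℕ => (k : ℝ) * (Real.logb 2 ((n : ℝ) + 1) / n)) atTop (𝓝 0) := by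
  have h1 : Tendsto (fun x : ℝ => Real.log x / x) atTop (𝓝 0) :=
    Real.isLittleO_log_id_atTop.tendsto_div_nhds_zero
  have h2 : Tendsto (fun n : ℕ => Real.log ((n : ℝ) + 1) / ((n : ℝ) + 1)) atTop (𝓝 0) :=
    h1.comp (tendsto_natCast_atTop_atTop.atTop_add tendsto_const_nhds)
  have h3 : Tendsto (fun n : ℕ => ((n : ℝ) + 1) / n) atTop (𝓝 1) := by
    have : Tendsto (fun n : ℕ => 1 + 1 / (n : ℝ)) atTop (𝓝 (1 + 0)) :=
      tendsto_const_nhds.add tendsto_one_div_atTop_nhds_zero_nat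
    rw [add_zero] at this
    refine this.congr' ?_
    filter_upwards [eventually_ne_atTop 0] with n hn
    have : (n : ℝ) ≠ 0 := by exact_mod_cast hn
    field_simp
  have h4 := ((h2.mul h3).div_const (Real.log 2)).const_mul (k : ℝ)
  simp only [zero_mul, zero_div, mul_zero] at h4
  refine h4.congr fun n => ?_
  have : (n : ℝ) + 1 ≠ 0 := by positivity
  rw [Real.logb]
  field_simp

/-- Shifting a radius by k log(n+1)/n compensates exactly the polynomial factor of the method of
types. -/
theorem two_rpow_mul_logb_div {n : ℕ} (hn : n ≠ 0) (k : ℕ) :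
    (2 : ℝ) ^ ((n : ℝ) * ((k : ℝ) * (Real.logb 2 ((n : ℝ) + 1) / n))) = ((n : ℝ) + 1) ^ k := by
  have hn' : (n : ℝ) ≠ 0 := by exact_mod_cast hn
  have e : (n : ℝ) * ((k : ℝ) * (Real.logb 2 ((n : ℝ) + 1) / n)) =
      Real.logb 2 ((n : ℝ) + 1) * k := by field_simp
  rw [e, Real.rpow_mul two_pos.le, Real.rpow_logb two_pos (by norm_num) (by positivity),
    Real.rpow_natCast]

theorem eventually_pow_le_two_rpow (k : ℕ) {δ : ℝ} (hδ : 0 < δ) :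
    ∀ᶠ n : ℕ in atTop, ((n : ℝ) + 1) ^ k ≤ (2 : ℝ) ^ ((n : ℝ) * δ) := by
  filter_upwards [(tendsto_mul_logb_div k).eventually_lt_const hδ, eventually_ne_atTop 0]
    with n hn hn0
  rw [← two_rpow_mul_logb_div hn0 k]
  exact Real.rpow_le_rpow_of_exponent_le one_le_two
    (mul_le_mul_of_nonneg_left hn.le (Nat.cast_nonneg n))

theorem le_errorExponent {n : ℕ} (hn : n ≠ 0) {p c : ℝ} (hp : 0 ≤ p)
    (h : p ≤ (2 : ℝ) ^ (-(n * c))) : (c : EReal) ≤ errorExponent n p := by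
  rw [errorExponent]
  split_ifs with h0
  · exact le_top
  · have hn' : (0 : ℝ) < n := by exact_mod_cast Nat.pos_of_ne_zero hn
    have hp' : 0 < p := lt_of_le_of_ne hp (Ne.symm h0)
    have h1 := (Real.logb_le_iff_le_rpow one_lt_two hp').2 h
    rw [EReal.coe_le_coe_iff]
    have h2 := mul_le_mul_of_nonneg_left h1 (one_div_pos.2 hn').le
    have h3 : 1 / (n : ℝ) * -(n * c) = -c := by field_simp
    linarith

theorem errorExponent_le {n : ℕ} (hn : n ≠ 0) {p c : ℝ}
    (h : (2 : ℝ) ^ (-(n * c)) ≤ p) : errorExponent n p ≤ (c : EReal) := by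
  have hn' : (0 : ℝ) < n := by exact_mod_cast Nat.pos_of_ne_zero hn
  have hp' : 0 < p := lt_of_lt_of_le (by positivity) h
  rw [errorExponent, if_neg hp'.ne', EReal.coe_le_coe_iff]
  have h1 := (Real.le_logb_iff_rpow_le one_lt_two hp').2 h
  have h2 := mul_le_mul_of_nonneg_left h1 (one_div_pos.2 hn').le
  have h3 : 1 / (n : ℝ) * -(n * c) = -c := by field_simp
  linarith

/-- Probability that a sequence emitted by `PY` can be moved by an admissible map to a type whose
divergence from `PX` is less than `mu`. -/
noncomputable def reachProb {k : ℕ} (v PX PY : Fin k → ℝ) (L : ℝ) (n : ℕ) (mu : ℝ) : ℝ :=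
  open Classical in
  ∑ y : Fin n → Fin k, if ∃ T ∈ admissibleMaps v L n (empiricalPmf y),
    klBits (outputMarginal T) PX < (mu : EReal) then seqProb PY y else 0

section

variable {k : ℕ} {v PX PY : Fin k → ℝ} {L : ℝ}

theorem reachProb_mono (hPY : ∀ a, 0 ≤ PY a) (n : ℕ) {mu mu' : ℝ} (h : mu ≤ mu') :
    reachProb v PX PY L n mu ≤ reachProb v PX PY L n mu' := by
  classical
  refine Finset.sum_le_sum fun y _ => ?_
  by_cases h1 : ∃ T ∈ admissibleMaps v L n (empiricalPmf y),
    klBits (outputMarginal T) PX < (mu : EReal)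
  · obtain ⟨T, hT, hlt⟩ := h1
    rw [if_pos ⟨T, hT, hlt⟩, if_pos ⟨T, hT, hlt.trans_le (EReal.coe_le_coe_iff.2 h)⟩]
  · rw [if_neg h1]
    split_ifs
    exacts [seqProb_nonneg hPY y, le_rfl]

theorem reachProb_nonneg (hPY : ∀ a, 0 ≤ PY a) (n : ℕ) (mu : ℝ) :
    0 ≤ reachProb v PX PY L n mu := by
  classical
  refine Finset.sum_nonneg fun y _ => ?_
  split_ifs
  exacts [seqProb_nonneg hPY y, le_rfl]

theorem mem_feasibleMaps_of_mem_admissibleMaps {n : ℕ} (hn : n ≠ 0) (hL : 0 ≤ L)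
    {y : Fin n → Fin k} {T : Fin k → Fin k → ℝ} (hT : T ∈ admissibleMaps v L n (empiricalPmf y))
    (hy : seqProb PY y ≠ 0) (hX : klBits (outputMarginal T) PX ≠ ⊤) :
    T ∈ feasibleMaps v PX PY L := by
  obtain ⟨⟨N, hN⟩, hrow, hd⟩ := hT
  have h0 : ∀ i j, 0 ≤ T i j := fun i j => by rw [hN]; positivity
  refine ⟨h0, ?_, ?_⟩
  · rw [Finset.sum_congr rfl fun i _ => hrow i, sum_empiricalPmf hn y]
  · rintro i j (hij | hi | hj)
    · by_contra hne
      exact ((maxShipment_le_iff v T hL).1 hd i j hne).not_gt hij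
    · exact (Finset.sum_eq_zero_iff_of_nonneg fun j _ => h0 i j).1
        ((hrow i).trans (empiricalPmf_eq_zero_of_seqProb_ne_zero hy i hi)) j (Finset.mem_univ j)
    · exact (Finset.sum_eq_zero_iff_of_nonneg fun i _ => h0 i j).1
        (eq_zero_of_klBits_ne_top hX j hj) i (Finset.mem_univ i)

/-- Sanov upper bound: the type of each counted sequence of positive probability is the input
marginal of a feasible map reaching the ball. -/
theorem reachProb_le (hPY : ∀ a, 0 ≤ PY a) (hL : 0 ≤ L) {n : ℕ} (hn : n ≠ 0) {mu c : ℝ}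
    (h : ∀ S ∈ feasibleMaps v PX PY L, klReal (outputMarginal S) PX < mu →
      c ≤ klReal (inputMarginal S) PY) :
    reachProb v PX PY L n mu ≤ ((n : ℝ) + 1) ^ k * (2 : ℝ) ^ (-(n * c)) := by
  classical
  rw [reachProb, ← Finset.sum_filter]
  refine sum_seqProb_le_of_le_klReal hn hPY _ fun y hy hy0 => ?_
  obtain ⟨T, hT, hlt⟩ := (Finset.mem_filter.1 hy).2
  have hK := mem_feasibleMaps_of_mem_admissibleMaps hn hL hT hy0 hlt.ne_top
  rw [klBits_eq_coe (outputMarginal_eq_zero hK), EReal.coe_lt_coe_iff] at hlt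
  have he : inputMarginal T = empiricalPmf y := funext hT.2.1
  rw [← he]
  exact h T hK hlt

/-- The map `S` is admissible for every sequence whose type is its input marginal, so the whole type
class is counted. -/
theorem le_reachProb (hPY : ∀ a, 0 ≤ PY a) (hL : 0 ≤ L) {n : ℕ} (hn : n ≠ 0) {mu : ℝ}
    {S : Fin k → Fin k → ℝ} (hS : S ∈ feasibleMaps v PX PY L)
    (N : Fin k → Fin k → ℕ) (hN : ∀ i j, S i j = (N i j : ℝ) / n)
    (h : klReal (outputMarginal S) PX < mu) :
    (2 : ℝ) ^ (-(n * klReal (inputMarginal S) PY)) ≤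
      ((n : ℝ) + 1) ^ k * reachProb v PX PY L n mu := by
  classical
  have hn' : (n : ℝ) ≠ 0 := by exact_mod_cast hn
  have hp : inputMarginal S = fun i => ((∑ j, N i j : ℕ) : ℝ) / n := by
    funext i
    simp only [inputMarginal, hN, ← Finset.sum_div]
    push_cast
    rfl
  have hsum : ∑ i, ∑ j, N i j = n := by
    have h1 := hS.2.1
    simp only [hN, ← Finset.sum_div] at h1
    rw [div_eq_one_iff_eq hn'] at h1
    exact_mod_cast h1
  have hzero : ∀ a, PY a = 0 → ∑ j, N a j = 0 := by
    intro a ha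
    have h1 := inputMarginal_eq_zero hS a ha
    rw [hp, div_eq_zero_iff, or_iff_left hn'] at h1
    exact_mod_cast h1
  rw [hp]
  refine (rpow_le_mul_sum_seqProb_typeClass hn hPY _ hsum hzero).trans ?_
  refine mul_le_mul_of_nonneg_left ?_ (by positivity)
  rw [reachProb, ← Finset.sum_filter]
  refine Finset.sum_le_sum_of_subset_of_nonneg ?_ fun y _ _ => seqProb_nonneg hPY y
  intro y hy
  refine Finset.mem_filter.2 ⟨Finset.mem_univ y, S, ⟨⟨N, hN⟩, fun i => ?_, ?_⟩, ?_⟩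
  · rw [empiricalPmf_apply, (Finset.mem_filter.1 hy).2]
    exact congrFun hp i
  · refine (maxShipment_le_iff v S hL).2 fun i j hij => ?_
    by_contra! hlt
    exact hij (hS.2.2 i j (Or.inl hlt))
  · rw [klBits_eq_coe (outputMarginal_eq_zero hS)]
    exact EReal.coe_lt_coe_iff.2 h

/-- Feasible maps are limits of feasible maps with entries in `ℕ / n`. -/
theorem exists_tendsto_feasibleMaps {S : Fin k → Fin k → ℝ} (hS : S ∈ feasibleMaps v PX PY L) :
    ∃ N : ℕ → Fin k → Fin k → ℕ,
      (∀ n, n ≠ 0 → (fun i j => (N n i j : ℝ) / n) ∈ feasibleMaps v PX PY L) ∧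
      Tendsto (fun n => fun i j => (N n i j : ℝ) / n) atTop (𝓝 S) := by
  classical
  -- Entries are rounded down and the missing mass goes to one cell already in use, so that no
  -- forbidden cell becomes nonzero.
  obtain ⟨i₀, j₀, h₀⟩ : ∃ i₀ j₀, S i₀ j₀ ≠ 0 := by
    by_contra! hcon
    have := hS.2.1
    simp [hcon] at this
  let F : ℕ → Fin k → Fin k → ℕ := fun n i j => ⌊S i j * n⌋₊
  have hF : ∀ n, ∑ i, ∑ j, F n i j ≤ n := by
    intro n
    have : ∑ i, ∑ j, (F n i j : ℝ) ≤ n := by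
      calc ∑ i, ∑ j, (F n i j : ℝ) ≤ ∑ i, ∑ j, S i j * n :=
            Finset.sum_le_sum fun i _ => Finset.sum_le_sum fun j _ =>
              Nat.floor_le (mul_nonneg (hS.1 i j) (Nat.cast_nonneg n))
        _ = n := by simp_rw [← Finset.sum_mul]; rw [hS.2.1, one_mul]
    exact_mod_cast this
  let r : ℕ → ℕ := fun n => n - ∑ i, ∑ j, F n i j
  have hr : ∀ n, ∑ i, ∑ j, F n i j + r n = n := fun n => Nat.add_sub_of_le (hF n)
  have hFt : ∀ i j, Tendsto (fun n => (F n i j : ℝ) / n) atTop (𝓝 (S i j)) := fun i j =>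
    (tendsto_nat_floor_mul_div_atTop (hS.1 i j)).comp tendsto_natCast_atTop_atTop
  have hrt : Tendsto (fun n => (r n : ℝ) / n) atTop (𝓝 0) := by
    have h1 : Tendsto (fun n => 1 - ∑ i, ∑ j, (F n i j : ℝ) / n) atTop
        (𝓝 (1 - ∑ i, ∑ j, S i j)) :=
      tendsto_const_nhds.sub (tendsto_finsetSum _ fun i _ => tendsto_finsetSum _ fun j _ => hFt i j)
    rw [hS.2.1, sub_self] at h1
    refine h1.congr' ?_
    filter_upwards [eventually_ne_atTop 0] with n hn
    have hn' : (n : ℝ) ≠ 0 := by exact_mod_cast hn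
    have h2 : (∑ i, ∑ j, (F n i j : ℝ)) + r n = n := by exact_mod_cast hr n
    simp_rw [← Finset.sum_div]
    rw [eq_div_iff hn', sub_mul, div_mul_cancel₀ _ hn']
    linarith
  refine ⟨fun n i j => F n i j + if i = i₀ ∧ j = j₀ then r n else 0, fun n hn => ?_, ?_⟩
  · have hn' : (n : ℝ) ≠ 0 := by exact_mod_cast hn
    refine ⟨fun i j => by positivity, ?_, fun i j hij => ?_⟩
    · simp_rw [← Finset.sum_div]
      rw [div_eq_one_iff_eq hn']
      have : ∑ i, ∑ j, (F n i j + if i = i₀ ∧ j = j₀ then r n else 0) = n := by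
        simp_rw [Finset.sum_add_distrib]
        have e : ∑ i, ∑ j, (if i = i₀ ∧ j = j₀ then r n else 0) = r n := by
          simp [ite_and]
        rw [e, hr n]
      exact_mod_cast this
    · have hz := hS.2.2 i j hij
      have h1 : ¬(i = i₀ ∧ j = j₀) := by
        rintro ⟨rfl, rfl⟩
        exact h₀ hz
      simp [F, hz, h1]
  · refine tendsto_pi_nhds.2 fun i => tendsto_pi_nhds.2 fun j => ?_
    by_cases h : i = i₀ ∧ j = j₀
    · have := (hFt i j).add hrt
      rw [add_zero] at this
      refine this.congr fun n => ?_
      dsimp only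
      rw [if_pos h]
      push_cast
      ring
    · refine (hFt i j).congr fun n => ?_
      dsimp only
      rw [if_neg h, add_zero]

/-- Both hypotheses on `S` are strict, hence survive discretization by continuity; the gap between
`c'` and `c` absorbs the polynomial factor. -/
theorem eventually_le_reachProb (hPY : ∀ a, 0 ≤ PY a) (hL : 0 ≤ L) {S : Fin k → Fin k → ℝ}
    (hS : S ∈ feasibleMaps v PX PY L) {lam c : ℝ} (hlam : klReal (outputMarginal S) PX < lam)
    (hc : klReal (inputMarginal S) PY < c) {mu : ℕ → ℝ} (hmu : Tendsto mu atTop (𝓝 lam)) :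
    ∀ᶠ n : ℕ in atTop, (2 : ℝ) ^ (-(n * c)) ≤ reachProb v PX PY L n (mu n) := by
  obtain ⟨c', hfc', hc'c⟩ := exists_between hc
  obtain ⟨N, hNK, hNt⟩ := exists_tendsto_feasibleMaps hS
  have hf := (((continuous_klReal PY).comp continuous_inputMarginal).tendsto S).comp hNt
  have hg := (((continuous_klReal PX).comp continuous_outputMarginal).tendsto S).comp hNt
  filter_upwards [hf.eventually_lt_const hfc', hg.eventually_lt hmu hlam,
    eventually_pow_le_two_rpow k (sub_pos.2 hc'c), eventually_ne_atTop 0] with n h1 h2 h3 hn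
  have h4 := le_reachProb hPY hL hn (hNK n hn) (N n) (fun _ _ => rfl) h2
  have h5 : (2 : ℝ) ^ (-(n * c')) ≤
      (2 : ℝ) ^ ((n : ℝ) * (c - c')) * reachProb v PX PY L n (mu n) := by
    refine (Real.rpow_le_rpow_of_exponent_le one_le_two (neg_le_neg
      (mul_le_mul_of_nonneg_left h1.le (Nat.cast_nonneg n)))).trans (h4.trans ?_)
    exact mul_le_mul_of_nonneg_right h3 (reachProb_nonneg hPY n _)
  have h6 : (2 : ℝ) ^ (-(n * c')) = (2 : ℝ) ^ ((n : ℝ) * (c - c')) * (2 : ℝ) ^ (-(n * c)) := by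
    rw [← Real.rpow_add two_pos]
    congr 1
    ring
  rw [h6] at h5
  exact le_of_mul_le_mul_left h5 (by positivity)

theorem eventually_reachProb_le (hPY : ∀ a, 0 ≤ PY a) (hL : 0 ≤ L) {ν c c' : ℝ} (hc : c' < c)
    (h : ∀ S ∈ feasibleMaps v PX PY L, klReal (outputMarginal S) PX < ν →
      c ≤ klReal (inputMarginal S) PY) :
    ∀ᶠ n : ℕ in atTop, reachProb v PX PY L n ν ≤ (2 : ℝ) ^ (-(n * c')) := by
  filter_upwards [eventually_pow_le_two_rpow k (sub_pos.2 hc), eventually_ne_atTop 0] with n h1 hn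
  refine (reachProb_le hPY hL hn h).trans ?_
  calc ((n : ℝ) + 1) ^ k * (2 : ℝ) ^ (-(n * c))
      ≤ (2 : ℝ) ^ ((n : ℝ) * (c - c')) * (2 : ℝ) ^ (-(n * c)) :=
        mul_le_mul_of_nonneg_right h1 (by positivity)
    _ = (2 : ℝ) ^ (-(n * c')) := by
        rw [← Real.rpow_add two_pos]
        congr 1
        ring

/-- A sequence of probabilities squeezed between probabilities of reaching a neighbourhood of `PX`
has the error exponent of the limiting neighbourhood. -/
theorem tendsto_errorExponent (hPY : ∀ a, 0 ≤ PY a) (hL : 0 ≤ L) {lam : ℝ} {p : ℕ → ℝ}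
    {mu mu' : ℕ → ℝ} (hmu : Tendsto mu atTop (𝓝 lam))
    (hlo : ∀ n, n ≠ 0 → reachProb v PX PY L n (mu n) ≤ p n)
    (hhi : ∀ n, n ≠ 0 → p n ≤ reachProb v PX PY L n (mu' n))
    (hsemi : ∀ c : ℝ, (c : EReal) < limitExponent v PX PY L lam →
      ∃ ν, (∀ᶠ n in atTop, mu' n ≤ ν) ∧ ∀ S ∈ feasibleMaps v PX PY L,
        klReal (outputMarginal S) PX < ν → c ≤ klReal (inputMarginal S) PY) :
    Tendsto (fun n => errorExponent n (p n)) atTop (𝓝 (limitExponent v PX PY L lam)) := by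
  refine tendsto_order.2 ⟨fun a ha => ?_, fun a ha => ?_⟩
  · obtain ⟨c', hac', hc'⟩ := EReal.lt_iff_exists_real_btwn.1 ha
    obtain ⟨c, hc'c, hc⟩ := EReal.lt_iff_exists_real_btwn.1 hc'
    obtain ⟨ν, hν, h⟩ := hsemi c hc
    filter_upwards [eventually_reachProb_le hPY hL (EReal.coe_lt_coe_iff.1 hc'c) h, hν,
      eventually_ne_atTop 0] with n h1 h2 hn
    exact hac'.trans_le (le_errorExponent hn
      ((reachProb_nonneg hPY n _).trans (hlo n hn))
      ((hhi n hn).trans ((reachProb_mono hPY n h2).trans h1)))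
  · obtain ⟨S, hS, hSl, hSa⟩ := exists_of_limitExponent_lt ha
    obtain ⟨c, hSc, hca⟩ := EReal.lt_iff_exists_real_btwn.1 hSa
    filter_upwards [eventually_le_reachProb hPY hL hS hSl (EReal.coe_lt_coe_iff.1 hSc) hmu,
      eventually_ne_atTop 0] with n h1 hn
    exact (errorExponent_le hn (h1.trans (hlo n hn))).trans_lt hca

end

/-! ### The game -/

section

variable {k : ℕ} {v PX PY : Fin k → ℝ} {L : ℝ}

theorem outputMarginal_mem_typesOfLength {n : ℕ} (hn : n ≠ 0) {y : Fin n → Fin k}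
    {T : Fin k → Fin k → ℝ} (hT : T ∈ admissibleMaps v L n (empiricalPmf y)) :
    outputMarginal T ∈ typesOfLength k n := by
  obtain ⟨⟨N, hN⟩, hrow, -⟩ := hT
  have hn' : (n : ℝ) ≠ 0 := by exact_mod_cast hn
  have hsum : ∑ j, ∑ i, N i j = n := by
    have h1 : ∑ i, ∑ j, T i j = 1 := by
      rw [Finset.sum_congr rfl fun i _ => hrow i, sum_empiricalPmf hn y]
    simp only [hN, ← Finset.sum_div] at h1
    rw [div_eq_one_iff_eq hn', Finset.sum_comm] at h1
    exact_mod_cast h1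
  obtain ⟨z, hz⟩ := exists_symbolCount_eq _ hsum
  refine ⟨z, funext fun j => ?_⟩
  change empiricalPmf z j = _
  rw [empiricalPmf_apply, hz]
  simp only [outputMarginal, hN, ← Finset.sum_div]
  push_cast
  rfl

theorem admissibleMaps_nonempty (hL : 0 ≤ L) {n : ℕ} (y : Fin n → Fin k) :
    (admissibleMaps v L n (empiricalPmf y)).Nonempty := by
  classical
  refine ⟨fun i j => if i = j then empiricalPmf y i else 0,
    ⟨fun i j => if i = j then symbolCount y i else 0, fun i j => ?_⟩, fun i => by simp,
    (maxShipment_le_iff v _ hL).2 fun i j hij => ?_⟩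
  · by_cases e : i = j
    · simp [e, empiricalPmf_apply]
    · simp [e]
  · by_cases e : i = j
    · simpa [e] using hL
    · simp [e] at hij

/-- There is an attack moving every sequence into the divergence ball around `PX`, if possible. -/
theorem exists_attack (hL : 0 ≤ L) (n : ℕ) (mu : EReal) :
    ∃ S ∈ attackerStrategies v L n, ∀ y : Fin n → Fin k,
      (∃ T ∈ admissibleMaps v L n (empiricalPmf y), klBits (outputMarginal T) PX < mu) →
        klBits (outputMarginal (S y)) PX < mu := by
  have h : ∀ y : Fin n → Fin k, ∃ S ∈ admissibleMaps v L n (empiricalPmf y),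
      (∃ T ∈ admissibleMaps v L n (empiricalPmf y), klBits (outputMarginal T) PX < mu) →
        klBits (outputMarginal S) PX < mu := by
    intro y
    by_cases hy : ∃ T ∈ admissibleMaps v L n (empiricalPmf y), klBits (outputMarginal T) PX < mu
    · obtain ⟨T, hT, hlt⟩ := hy
      exact ⟨T, hT, fun _ => hlt⟩
    · obtain ⟨T, hT⟩ := admissibleMaps_nonempty (v := v) hL y
      exact ⟨T, hT, fun h => absurd h hy⟩
  choose S hS hS' using h
  exact ⟨S, hS, hS'⟩

theorem falseNeg_nonneg (hPY : ∀ a, 0 ≤ PY a) (n : ℕ) (A : Set (Fin k → ℝ))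
    (S : (Fin n → Fin k) → Fin k → Fin k → ℝ) : 0 ≤ falseNeg PY n A S := by
  classical
  refine Finset.sum_nonneg fun y _ => ?_
  split_ifs
  exacts [seqProb_nonneg hPY y, le_rfl]

theorem falseNeg_le_one (hPY : PY ∈ stdSimplex ℝ (Fin k)) (n : ℕ) (A : Set (Fin k → ℝ))
    (S : (Fin n → Fin k) → Fin k → Fin k → ℝ) : falseNeg PY n A S ≤ 1 := by
  classical
  rw [← sum_seqProb n hPY.2]
  refine Finset.sum_le_sum fun y _ => ?_
  split_ifs
  exacts [le_rfl, seqProb_nonneg hPY.1 y]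

theorem falseNeg_le_reachProb (hPY : ∀ a, 0 ≤ PY a) {n : ℕ} {A : Set (Fin k → ℝ)} {mu : ℝ}
    (hA : ∀ P ∈ A, klBits P PX < (mu : EReal)) {S : (Fin n → Fin k) → Fin k → Fin k → ℝ}
    (hS : S ∈ attackerStrategies v L n) :
    falseNeg PY n A S ≤ reachProb v PX PY L n mu := by
  classical
  refine Finset.sum_le_sum fun y _ => ?_
  by_cases h : outputMarginal (S y) ∈ A
  · rw [if_pos h, if_pos ⟨S y, hS y, hA _ h⟩]
  · rw [if_neg h]
    split_ifs
    exacts [seqProb_nonneg hPY y, le_rfl]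

theorem reachProb_le_falseNeg (hPY : ∀ a, 0 ≤ PY a) {n : ℕ} {A : Set (Fin k → ℝ)} {mu : ℝ}
    {S : (Fin n → Fin k) → Fin k → Fin k → ℝ}
    (hS : ∀ y : Fin n → Fin k, (∃ T ∈ admissibleMaps v L n (empiricalPmf y),
      klBits (outputMarginal T) PX < (mu : EReal)) → outputMarginal (S y) ∈ A) :
    reachProb v PX PY L n mu ≤ falseNeg PY n A S := by
  classical
  refine Finset.sum_le_sum fun y _ => ?_
  by_cases h : ∃ T ∈ admissibleMaps v L n (empiricalPmf y),
      klBits (outputMarginal T) PX < (mu : EReal)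
  · rw [if_pos h, if_pos (hS y h)]
  · rw [if_neg h]
    split_ifs
    exacts [seqProb_nonneg hPY y, le_rfl]

/-- A divergence minimizer enters the ball whenever some admissible map does, so the choice of
minimizer is immaterial. -/
theorem falseNeg_optimalRegion_eq (hPY : ∀ a, 0 ≤ PY a) {n : ℕ} (hn : n ≠ 0) {lam : ℝ}
    {S : (Fin n → Fin k) → Fin k → Fin k → ℝ} (hS : IsOptimalAttack v PX L n S) :
    falseNeg PY n (optimalRegion PX lam n) S =
      reachProb v PX PY L n (lam - k * (Real.logb 2 (n + 1) / n)) := by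
  refine le_antisymm (falseNeg_le_reachProb hPY (fun P hP => hP.2) hS.1)
    (reachProb_le_falseNeg hPY ?_)
  rintro y ⟨T, hT, hlt⟩
  exact ⟨outputMarginal_mem_typesOfLength hn (hS.1 y), (hS.2 y T hT).trans_lt hlt⟩

/-- Every acceptance region with a small false positive probability contains the equilibrium
region. -/
theorem optimalRegion_subset (hPX : ∀ a, 0 ≤ PX a) {n : ℕ} (hn : n ≠ 0) {lam : ℝ}
    {A : Set (Fin k → ℝ)} (hA : A ∈ defenderStrategies PX lam n) : optimalRegion PX lam n ⊆ A := by
  classical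
  rintro _ ⟨⟨y₀, rfl⟩, hlt⟩
  by_contra hnot
  have hn' : (0 : ℝ) < n := by exact_mod_cast Nat.pos_of_ne_zero hn
  have h0 := eq_zero_of_klBits_ne_top hlt.ne_top
  rw [klBits_eq_coe h0, EReal.coe_lt_coe_iff] at hlt
  -- Rejecting one type rejects its whole class, already too likely for the false positive
  -- constraint.
  have h1 : ∑ y : Fin n → Fin k with symbolCount y = symbolCount y₀, seqProb PX y ≤
      falsePos PX n A := by
    rw [Finset.sum_filter, falsePos]
    refine Finset.sum_le_sum fun y _ => ?_
    by_cases h : symbolCount y = symbolCount y₀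
    · have he : empiricalPmf y = empiricalPmf y₀ := by
        funext a
        rw [empiricalPmf_apply, empiricalPmf_apply, h]
      rw [if_pos h, he, if_neg hnot]
    · rw [if_neg h]
      split_ifs
      exacts [le_rfl, seqProb_nonneg hPX y]
  have h2 := rpow_le_mul_sum_seqProb_typeClass hn hPX (symbolCount y₀) (sum_symbolCount y₀)
    fun a ha => by
      have : empiricalPmf y₀ a = 0 := h0 a ha
      rw [empiricalPmf_apply, div_eq_zero_iff, or_iff_left hn'.ne'] at this
      exact_mod_cast this
  have h3 := h2.trans (mul_le_mul_of_nonneg_left (h1.trans hA.2) (by positivity))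
  rw [← two_rpow_mul_logb_div hn k, ← Real.rpow_add two_pos] at h3
  have h4 := (Real.rpow_le_rpow_left_iff one_lt_two).1 h3
  have h5 := mul_lt_mul_of_pos_left hlt hn'
  change -(n * klReal (empiricalPmf y₀) PX) ≤ _ at h4
  linarith

theorem exists_reachProb_le_falseNeg (hPX : ∀ a, 0 ≤ PX a) (hPY : ∀ a, 0 ≤ PY a) (hL : 0 ≤ L)
    {n : ℕ} (hn : n ≠ 0) {lam : ℝ} {A : Set (Fin k → ℝ)} (hA : A ∈ defenderStrategies PX lam n) :
    ∃ S ∈ attackerStrategies v L n,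
      reachProb v PX PY L n (lam - k * (Real.logb 2 (n + 1) / n)) ≤ falseNeg PY n A S := by
  obtain ⟨S, hS, hS'⟩ := exists_attack (v := v) (PX := PX) hL n
    ((lam - k * (Real.logb 2 (n + 1) / n) : ℝ) : EReal)
  refine ⟨S, hS, reachProb_le_falseNeg hPY fun y hy => optimalRegion_subset hPX hn hA ?_⟩
  exact ⟨outputMarginal_mem_typesOfLength hn (hS y), hS' y hy⟩

/-- An acceptance region slightly larger than the equilibrium region, whose false positive
probability meets the constraint exactly. -/
def enlargedRegion (PX : Fin k → ℝ) (lam : ℝ) (n : ℕ) : Set (Fin k → ℝ) :=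
  {P | P ∈ typesOfLength k n ∧
    klBits P PX < ((lam + k * (Real.logb 2 (n + 1) / n) : ℝ) : EReal)}

theorem typesOfLength_mem_defenderStrategies (PX : Fin k → ℝ) (lam : ℝ) (n : ℕ) :
    typesOfLength k n ∈ defenderStrategies PX lam n := by
  refine ⟨subset_rfl, ?_⟩
  rw [falsePos, Finset.sum_eq_zero]
  · positivity
  · intro y _
    rw [if_pos ⟨y, rfl⟩]

/-- The method of types bounds the rejected mass by (n+1)^k times 2^(-n·radius). For the smaller
equilibrium radius this bound exceeds 2^(-λn), hence the enlargement. -/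
theorem enlargedRegion_mem_defenderStrategies (hPX : ∀ a, 0 ≤ PX a) {lam : ℝ} {n : ℕ}
    (hn : n ≠ 0) : enlargedRegion PX lam n ∈ defenderStrategies PX lam n := by
  classical
  refine ⟨fun P hP => hP.1, ?_⟩
  have h1 : falsePos PX n (enlargedRegion PX lam n) =
      ∑ y : Fin n → Fin k with empiricalPmf y ∉ enlargedRegion PX lam n, seqProb PX y := by
    rw [Finset.sum_filter, falsePos]
    refine Finset.sum_congr rfl fun y _ => ?_
    by_cases h : empiricalPmf y ∈ enlargedRegion PX lam n <;> simp [h]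
  rw [h1]
  refine (sum_seqProb_le_of_le_klReal hn hPX _
    (c := lam + k * (Real.logb 2 (n + 1) / n)) fun y hy hy0 => ?_).trans ?_
  · by_contra! hlt
    refine (Finset.mem_filter.1 hy).2 ⟨⟨y, rfl⟩, ?_⟩
    rw [klBits_eq_coe (empiricalPmf_eq_zero_of_seqProb_ne_zero hy0)]
    exact EReal.coe_lt_coe_iff.2 hlt
  · rw [← two_rpow_mul_logb_div hn k, ← Real.rpow_add two_pos]
    refine Real.rpow_le_rpow_of_exponent_le one_le_two (le_of_eq ?_)
    ring

theorem attackerStrategies_nonempty (v : Fin k → ℝ) (hL : 0 ≤ L) (n : ℕ) :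
    (attackerStrategies v L n).Nonempty := by
  -- Only admissibility is used, so `v` merely fills the place of a pmf.
  obtain ⟨S, hS, -⟩ := exists_attack (v := v) (PX := v) hL n ⊤
  exact ⟨S, hS⟩

theorem gameFalseNeg_le_reachProb (hPX : ∀ a, 0 ≤ PX a) (hPY : ∀ a, 0 ≤ PY a) (hL : 0 ≤ L)
    {n : ℕ} (hn : n ≠ 0) (lam : ℝ) :
    gameFalseNeg v PX PY L lam n ≤
      reachProb v PX PY L n (lam + k * (Real.logb 2 (n + 1) / n)) := by
  refine (csInf_le ⟨0, ?_⟩ (Set.mem_image_of_mem _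
    (enlargedRegion_mem_defenderStrategies hPX hn))).trans ?_
  · rintro _ ⟨A, -, rfl⟩
    refine Real.sSup_nonneg ?_
    rintro _ ⟨S, -, rfl⟩
    exact falseNeg_nonneg hPY n A S
  · refine csSup_le ((attackerStrategies_nonempty v hL n).image _) ?_
    rintro _ ⟨S, hS, rfl⟩
    exact falseNeg_le_reachProb hPY (fun P hP => hP.2) hS

theorem reachProb_le_gameFalseNeg (hPX : ∀ a, 0 ≤ PX a) (hPY : PY ∈ stdSimplex ℝ (Fin k))
    (hL : 0 ≤ L) {n : ℕ} (hn : n ≠ 0) (lam : ℝ) :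
    reachProb v PX PY L n (lam - k * (Real.logb 2 (n + 1) / n)) ≤
      gameFalseNeg v PX PY L lam n := by
  refine le_csInf ⟨_, typesOfLength k n, typesOfLength_mem_defenderStrategies PX lam n, rfl⟩ ?_
  rintro _ ⟨A, hA, rfl⟩
  obtain ⟨S, hS, h⟩ := exists_reachProb_le_falseNeg (v := v) hPX hPY.1 hL hn hA
  refine h.trans (le_csSup ⟨1, ?_⟩ ⟨S, hS, rfl⟩)
  rintro _ ⟨S, -, rfl⟩
  exact falseNeg_le_one hPY n A S

/-! ### Error exponents and the security margin -/

theorem tendsto_sub_mul_logb_div (k : ℕ) (lam : ℝ) :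
    Tendsto (fun n : ℕ => lam - k * (Real.logb 2 (n + 1) / n)) atTop (𝓝 lam) := by
  simpa using tendsto_const_nhds.sub (tendsto_mul_logb_div k)

theorem tendsto_add_mul_logb_div (k : ℕ) (lam : ℝ) :
    Tendsto (fun n : ℕ => lam + k * (Real.logb 2 (n + 1) / n)) atTop (𝓝 lam) := by
  simpa using tendsto_const_nhds.add (tendsto_mul_logb_div k)

theorem tendsto_errorExponent_optimal (hPY : ∀ a, 0 ≤ PY a) (hL : 0 ≤ L) (lam : ℝ)
    {S : (n : ℕ) → (Fin n → Fin k) → Fin k → Fin k → ℝ}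
    (hS : ∀ n, IsOptimalAttack v PX L n (S n)) :
    Tendsto (fun n : ℕ => errorExponent n (falseNeg PY n (optimalRegion PX lam n) (S n)))
      atTop (𝓝 (limitExponent v PX PY L lam)) := by
  refine tendsto_errorExponent hPY hL (tendsto_sub_mul_logb_div k lam)
    (fun n hn => (falseNeg_optimalRegion_eq hPY hn (hS n)).ge)
    (fun n hn => (falseNeg_optimalRegion_eq hPY hn (hS n)).le)
    -- The radii approach `lam` from below, so no semicontinuity is needed and every `lam` is
    -- allowed.
    fun c hc => ⟨lam, Eventually.of_forall fun n => ?_, fun S hS hSl => ?_⟩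
  · have : 0 ≤ Real.logb 2 ((n : ℝ) + 1) :=
      Real.logb_nonneg one_lt_two (by linarith [Nat.cast_nonneg (α := ℝ) n])
    have : 0 ≤ (k : ℝ) * (Real.logb 2 ((n : ℝ) + 1) / n) := by positivity
    linarith
  · exact (EReal.coe_lt_coe_iff.1 (hc.trans_le (limitExponent_le hS hSl))).le

/-- The upper radii approach `lam` from above; this is where right semicontinuity, and with it the
restriction to small `lam`, enters. -/
theorem eventually_tendsto_errorExponent_game (hPX : ∀ a, 0 ≤ PX a)
    (hPY : PY ∈ stdSimplex ℝ (Fin k)) (hL : 0 ≤ L) :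
    ∀ᶠ lam in 𝓝[>] (0 : ℝ),
      Tendsto (fun n : ℕ => errorExponent n (gameFalseNeg v PX PY L lam n))
        atTop (𝓝 (limitExponent v PX PY L lam)) := by
  filter_upwards [eventually_exists_gt_forall_le (v := v) (L := L) hPX hPY.1] with lam hlam
  refine tendsto_errorExponent hPY.1 hL (tendsto_sub_mul_logb_div k lam)
    (fun n hn => reachProb_le_gameFalseNeg hPX hPY hL hn lam)
    (fun n hn => gameFalseNeg_le_reachProb hPX hPY.1 hL hn lam) fun c hc => ?_
  obtain ⟨ν, hν, h⟩ := hlam c hc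
  exact ⟨ν, ((tendsto_add_mul_logb_div k lam).eventually_lt_const hν).mono fun n hn => hn.le, h⟩

theorem klBits_pos {P Q : Fin k → ℝ} (hP : P ∈ stdSimplex ℝ (Fin k))
    (hQ : Q ∈ stdSimplex ℝ (Fin k)) (hne : P ≠ Q) : 0 < klBits P Q := by
  by_cases htop : klBits P Q = ⊤
  · rw [htop]; exact EReal.zero_lt_top
  · have h0 := eq_zero_of_klBits_ne_top htop
    rw [klBits_eq_coe h0]
    refine EReal.coe_pos.2 ?_
    by_contra! hle
    exact hne (eq_of_klReal_nonpos hP hQ h0 hle)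

theorem reliablyDistinguishable_iff (hv : StrictMono v) (hPX : PX ∈ stdSimplex ℝ (Fin k))
    (hPY : PY ∈ stdSimplex ℝ (Fin k)) (hL : 0 ≤ L) :
    ReliablyDistinguishable v PX PY L ↔ L < maxShipment v (nwcMap PY PX) := by
  constructor
  · rintro ⟨lam, hlam, e, he, A, hA, hev⟩
    by_contra! hle
    -- A map from `PY` to `PX` makes both divergences zero, so the attacker achieves probability at
    -- least 2^(-ne/2), contradicting the exponent `e`.
    obtain ⟨S, hS, hSY, hSX⟩ := exists_feasibleMap_of_mem_smallestRegion hv hPX hL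
      (⟨hPY, hle⟩ : PY ∈ smallestRegion v PX L) (PY := PY) fun _ h => h
    have hself : ∀ P : Fin k → ℝ, klReal P P = 0 := fun P => by
      have h1 := klBits_self P
      rwa [klBits_eq_coe fun _ h => h, EReal.coe_eq_zero] at h1
    have hev' := eventually_le_reachProb hPY.1 hL hS (lam := lam) (c := e / 2)
      (by rw [hSX, hself]; exact hlam) (by rw [hSY, hself]; exact half_pos he)
      (tendsto_sub_mul_logb_div k lam)
    obtain ⟨n, h1, h2, hn⟩ := (hev.and (hev'.and (eventually_ne_atTop 0))).exists
    obtain ⟨T, hT, h3⟩ := exists_reachProb_le_falseNeg (v := v) hPX.1 hPY.1 hL hn (hA n)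
    have h4 := (Real.rpow_le_rpow_left_iff one_lt_two).1 (h2.trans (h3.trans (h1 T hT)))
    have hn' : (0 : ℝ) < n := by exact_mod_cast Nat.pos_of_ne_zero hn
    have := mul_pos he hn'
    linarith
  · intro hlt
    obtain ⟨P₀, hP₀, hmin⟩ := exists_isMinOn_smallestRegion (PY := PY) hv hPX hL
    have hne : P₀ ≠ PY := by
      rintro rfl
      exact hP₀.2.not_gt hlt
    obtain ⟨c, hc0, hc⟩ := EReal.lt_iff_exists_real_btwn.1 (klBits_pos hP₀.1 hPY hne)
    have hc0 : 0 < c := EReal.coe_pos.1 hc0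
    obtain ⟨ν, hν, hν0⟩ := (((tendsto_limitExponent hv hPX hL hP₀ hmin).eventually_const_lt hc).and
      self_mem_nhdsWithin).exists
    have hν0 : 0 < ν := hν0
    classical
    -- Halving ν keeps the enlarged radius eventually below ν; halving `c` absorbs the polynomial
    -- factor. At n = 0 accepting every type satisfies the constraint.
    refine ⟨ν / 2, half_pos hν0, c / 2, half_pos hc0,
      fun n => if n = 0 then typesOfLength k n else enlargedRegion PX (ν / 2) n, fun n => ?_, ?_⟩
    · dsimp only
      split_ifs with hn
      exacts [typesOfLength_mem_defenderStrategies PX _ n,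
        enlargedRegion_mem_defenderStrategies hPX.1 hn]
    · filter_upwards [eventually_reachProb_le hPY.1 hL (half_lt_self hc0) fun S hS hSl =>
          (EReal.coe_lt_coe_iff.1 (hν.trans_le (limitExponent_le hS hSl))).le,
        (tendsto_add_mul_logb_div k (ν / 2)).eventually_lt_const (half_lt_self hν0),
        eventually_ne_atTop 0] with n h1 h2 hn S hS
      rw [if_neg hn, mul_comm (c / 2)]
      exact (falseNeg_le_reachProb hPY.1 (fun P hP => hP.2) hS).trans
        ((reachProb_mono hPY.1 n h2.le).trans h1)

theorem securityMargin_eq (hv : StrictMono v) (hPX : PX ∈ stdSimplex ℝ (Fin k))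
    (hPY : PY ∈ stdSimplex ℝ (Fin k)) :
    securityMargin v PX PY = maxShipment v (nwcMap PY PX) := by
  have e : {L : ℝ | 0 ≤ L ∧ ReliablyDistinguishable v PX PY L} =
      Set.Ico 0 (maxShipment v (nwcMap PY PX)) := by
    ext L
    exact and_congr_right fun hL => reliablyDistinguishable_iff hv hPX hPY hL
  rw [securityMargin, e]
  rcases (maxShipment_nonneg v (nwcMap PY PX)).eq_or_lt with h | h
  -- With zero margin no `L` qualifies, and the supremum of the empty set is 0 as required.
  · rw [← h, Set.Ico_self, Real.sSup_empty]
  · exact csSup_Ico h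

end

theorem theorem7 {k : ℕ} (v : Fin k → ℝ) (hv : StrictMono v)
    (PX PY : Fin k → ℝ) (hPX : PX ∈ stdSimplex ℝ (Fin k)) (hPY : PY ∈ stdSimplex ℝ (Fin k)) :
    (∀ L : ℝ, 0 ≤ L →
      ∃ P₀ ∈ smallestRegion v PX L,
        IsMinOn (fun P => klBits P PY) (smallestRegion v PX L) P₀ ∧
        ∃ ε : ℝ → EReal,
          (∀ lam : ℝ, 0 < lam →
            ∀ S : (n : ℕ) → (Fin n → Fin k) → Fin k → Fin k → ℝ,
              (∀ n, IsOptimalAttack v PX L n (S n)) →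
              Tendsto (fun n : ℕ => errorExponent n (falseNeg PY n (optimalRegion PX lam n) (S n)))
                atTop (𝓝 (ε lam))) ∧
          (∀ᶠ lam in 𝓝[>] (0 : ℝ),
            Tendsto (fun n : ℕ => errorExponent n (gameFalseNeg v PX PY L lam n))
              atTop (𝓝 (ε lam))) ∧
          Tendsto ε (𝓝[>] (0 : ℝ)) (𝓝 (klBits P₀ PY))) ∧
    (∀ L : ℝ, 0 ≤ L →
      (ReliablyDistinguishable v PX PY L ↔ L < maxShipment v (nwcMap PY PX))) ∧
    securityMargin v PX PY = maxShipment v (nwcMap PY PX) := by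
  refine ⟨fun L hL => ?_, fun L hL => reliablyDistinguishable_iff hv hPX hPY hL,
    securityMargin_eq hv hPX hPY⟩
  obtain ⟨P₀, hP₀, hmin⟩ := exists_isMinOn_smallestRegion (PY := PY) hv hPX hL
  exact ⟨P₀, hP₀, hmin, limitExponent v PX PY L,
    fun lam _ S hS => tendsto_errorExponent_optimal hPY.1 hL lam hS,
    eventually_tendsto_errorExponent_game hPX.1 hPY hL,
    tendsto_limitExponent hv hPX hL hP₀ hmin⟩
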